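/- Let $H,K$ be complex Hilbert spaces, $\mathscr M\subseteq B(H)$ and $\mathscr N\subseteq B(K)$ von Neumann algebras, and $\Phi:\mathscr M\to\mathscr N$ a unital normal $*$-homomorphism (normal: $\Phi$ preserves least upper bounds of upward directed sets of self-adjoint operators). Operators $T$ are linear maps defined on a linear subspace $\mathrm{dom}(T)$, not necessarily dense or closed. For bounded everywhere-defined $A,B$ with $\mathrm{null}(B)\subseteq\mathrm{null}(A)$, let $A/B$ be the operator with domain $\mathrm{ran}(B)$ given by $Bx\mapsto Ax$. Put $$\mathscr M_{\mathrm{aff}}=\{A/B: A,B\in\mathscr M,\ \mathrm{null}(B)\subseteq\mathrm{null}(A)\},\qquad \mathrm{Aff}_s(\mathscr M)=\{\mathrm{ran}(A):A\in\mathscr M\},$$ $$\mathscr M_{\mathrm{aff}}^{\mathrm{MvN}}=\{T \text{ closed}: U^*TU=T\text{ for all unitaries }U\in\mathscr M'\},$$ and likewise for $\mathscr N$. Define $\Phi_{\mathrm{aff}}:\mathscr M_{\mathrm{aff}}\to\mathscr N_{\mathrm{aff}}$ by $\Phi_{\mathrm{aff}}(A/B)=\Phi(A)/\Phi(B)$ and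 $\Phi^s_{\mathrm{aff}}:\mathrm{Aff}_s(\mathscr M)\to\mathrm{Aff}_s(\mathscr N)$ by $\Phi^s_{\mathrm{aff}}(\mathrm{ran}(A))=\mathrm{ran}(\Phi(A))$. These maps are well defined (in particular $\mathrm{null}(\Phi(B))\subseteq\mathrm{null}(\Phi(A))$ whenever $A,B\in\mathscr M$ and $\mathrm{null}(B)\subseteq\mathrm{null}(A)$), and for every $T\in\mathscr M_{\mathrm{aff}}$: (i) $\mathrm{dom}(\Phi_{\mathrm{aff}}(T))=\Phi^s_{\mathrm{aff}}(\mathrm{dom}(T))$; if $T$ is densely defined, then so is $\Phi_{\mathrm{aff}}(T)$. (ii) If $T$ is closed and bounded (on its domain), then so is $\Phi_{\mathrm{aff}}(T)$. (iii) If $T$ is closed, then so is $\Phi_{\mathrm{aff}}(T)$. (iv) If $T$ is pre-closed (that is, the closure of its graph is the graph of an operator $\overline T$), then so is $\Phi_{\mathrm{aff}}(T)$; furthermore $\overline T\in\mathscr M_{\mathrm{aff}}$ and $\Phi_{\mathrm{aff}}(\overline T)=\overline{\Phi_{\mathrm{aff}}(T)}$. Moreover $\mathscr M_{\mathrm{aff}}^{\mathrm{MvN}}\subseteq\mathscr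 M_{\mathrm{aff}}$, and $\Phi_{\mathrm{aff}}$ maps $\mathscr M_{\mathrm{aff}}^{\mathrm{MvN}}$ into $\mathscr N_{\mathrm{aff}}^{\mathrm{MvN}}$, sending densely defined operators to densely defined ones. -/

import Mathlib

noncomputable section

section Quotients

variable {H : Type*} [NormedAddCommGroup H] [InnerProductSpace ℂ H]

/-- The quotient `A / B` of bounded operators: the operator with domain `ran B` that sends `B x`
to `A x`, i.e. the partial linear map with graph `{(B x, A x)}`. It is meaningful exactly when
`null B ⊆ null A` (see `opQuot_domain` and `opQuot_apply`), and it is used only then. -/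
def opQuot (A B : H →L[ℂ] H) : H →ₗ.[ℂ] H :=
  (LinearMap.range ((B : H →ₗ[ℂ] H).prod (A : H →ₗ[ℂ] H))).toLinearPMap

theorem opQuot_domain (A B : H →L[ℂ] H) :
    (opQuot A B).domain = LinearMap.range (B : H →ₗ[ℂ] H) := by
  ext x
  simp [opQuot, Submodule.toLinearPMap_domain]

theorem opQuot_graph {A B : H →L[ℂ] H}
    (h : LinearMap.ker (B : H →ₗ[ℂ] H) ≤ LinearMap.ker (A : H →ₗ[ℂ] H)) :
    (opQuot A B).graph = LinearMap.range ((B : H →ₗ[ℂ] H).prod (A : H →ₗ[ℂ] H)) := by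
  refine Submodule.toLinearPMap_graph_eq _ ?_
  rintro _ ⟨x, rfl⟩ hx
  exact h hx

theorem opQuot_apply {A B : H →L[ℂ] H}
    (h : LinearMap.ker (B : H →ₗ[ℂ] H) ≤ LinearMap.ker (A : H →ₗ[ℂ] H))
    (x : H) (hx : B x ∈ (opQuot A B).domain) : opQuot A B ⟨B x, hx⟩ = A x := by
  have hmem : (B x, A x) ∈ (opQuot A B).graph := by
    rw [opQuot_graph h]
    exact ⟨x, rfl⟩
  exact ((opQuot A B).image_iff hx).2 hmem |>.symm

/-- `T` is bounded on its domain. -/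
def IsBddOp (T : H →ₗ.[ℂ] H) : Prop :=
  ∃ C : ℝ, ∀ x : T.domain, ‖T x‖ ≤ C * ‖(x : H)‖

/-- `T` is densely defined. -/
def IsDenselyDefined (T : H →ₗ.[ℂ] H) : Prop :=
  Dense (T.domain : Set H)

/-- The operator `U* T U`, with domain `{x | U x ∈ dom T}`. -/
def conjOp [CompleteSpace H] (U : H →L[ℂ] H) (T : H →ₗ.[ℂ] H) : H →ₗ.[ℂ] H where
  domain := T.domain.comap (U : H →ₗ[ℂ] H)
  toFun := ((star U : H →L[ℂ] H) : H →ₗ[ℂ] H) ∘ₗ T.toFun ∘ₗ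
    (U : H →ₗ[ℂ] H).restrict (fun _ hx => hx)

end Quotients

section Affiliated

variable {H : Type*} [NormedAddCommGroup H] [InnerProductSpace ℂ H] [CompleteSpace H]
variable {K : Type*} [NormedAddCommGroup K] [InnerProductSpace ℂ K] [CompleteSpace K]

/-- The set of operators affiliated with `M`: all quotients `A / B` with `A, B ∈ M` and
`null B ⊆ null A`. -/
def affOps (M : VonNeumannAlgebra H) : Set (H →ₗ.[ℂ] H) :=
  {T | ∃ A B : M.toStarSubalgebra,
    LinearMap.ker ((B : H →L[ℂ] H) : H →ₗ[ℂ] H) ≤ LinearMap.ker ((A : H →L[ℂ] H) : H →ₗ[ℂ] H) ∧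
      T = opQuot (A : H →L[ℂ] H) (B : H →L[ℂ] H)}

/-- The set of subspaces affiliated with `M`: all ranges of operators in `M`. -/
def affSubspaces (M : VonNeumannAlgebra H) : Set (Submodule ℂ H) :=
  {V | ∃ A : M.toStarSubalgebra, V = LinearMap.range ((A : H →L[ℂ] H) : H →ₗ[ℂ] H)}

theorem domain_mem_affSubspaces {M : VonNeumannAlgebra H} (T : affOps M) :
    T.1.domain ∈ affSubspaces M := by
  obtain ⟨T, A, B, -, rfl⟩ := T
  exact ⟨B, opQuot_domain _ _⟩

/-- The closed operators affiliated with `M` in the sense of Murray and von Neumann: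
`U* T U = T` for all unitaries `U` in the commutant of `M`. -/
def mvnAffOps (M : VonNeumannAlgebra H) : Set (H →ₗ.[ℂ] H) :=
  {T | T.IsClosed ∧ ∀ U ∈ M.commutant, U ∈ unitary (H →L[ℂ] H) → conjOp U T = T}

/-- A `*`-homomorphism of von Neumann algebras is normal if it preserves least upper bounds of
(nonempty) upward directed sets of self-adjoint operators. -/
def IsNormalHom {M : VonNeumannAlgebra H} {N : VonNeumannAlgebra K}
    (Φ : M.toStarSubalgebra →⋆ₐ[ℂ] N.toStarSubalgebra) : Prop :=
  ∀ (S : Set M.toStarSubalgebra) (A : M.toStarSubalgebra), S.Nonempty → DirectedOn (· ≤ ·) S →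
    (∀ B ∈ S, IsSelfAdjoint B) → IsLUB S A → IsLUB (Φ '' S) (Φ A)

/-- The map `Φ_aff^s` on affiliated subspaces: `ran A ↦ ran Φ(A)`, evaluated at a chosen `A ∈ M`
with the given range. -/
def phiAffS {M : VonNeumannAlgebra H} {N : VonNeumannAlgebra K}
    (Φ : M.toStarSubalgebra →⋆ₐ[ℂ] N.toStarSubalgebra) (V : affSubspaces M) : Submodule ℂ K :=
  LinearMap.range ((Φ V.2.choose : K →L[ℂ] K) : K →ₗ[ℂ] K)

/-- The map `Φ_aff` on affiliated operators: `A / B ↦ Φ(A) / Φ(B)`, evaluated at a chosen quotient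
representation of the given operator. -/
def phiAff {M : VonNeumannAlgebra H} {N : VonNeumannAlgebra K}
    (Φ : M.toStarSubalgebra →⋆ₐ[ℂ] N.toStarSubalgebra) (T : affOps M) : K →ₗ.[ℂ] K :=
  opQuot (Φ T.2.choose : K →L[ℂ] K) (Φ T.2.choose_spec.choose : K →L[ℂ] K)

end Affiliated

end

/-!
Every assertion about `Φ_aff` reduces to two kinds of facts about `A, B ∈ M`: algebraic identities
between elements of `M`, which any homomorphism preserves, and inclusions `ker B ≤ ker A`, which are
preserved because `Φ` is normal.

*Algebraic identities.* By Douglas' lemma an inclusion `ran A ≤ ran B` is an identity `A = B C`, and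
a bound `‖A x‖ ≤ c ‖B x‖` is an identity `A = W B`. The factors can be chosen canonically, hence
they commute with the commutant and lie in `M` by the double commutant property
(`exists_mul_eq_of_range_le`, `exists_mul_eq_of_norm_le`). This makes `Φ_aff` and `Φ_aff^s` well
defined and shows that boundedness is preserved. If the graph `{(B x, A x)}` is closed, the column
`(B, A)` has a left inverse on `(ker B)ᗮ` with entries in `M`
(`exists_left_inverse_of_isClosed`); applying `Φ` gives a left inverse of `(Φ B, Φ A)`, so the graph
of `Φ A / Φ B` is closed as well (`isClosed_opQuot_map`).

*Null spaces.* After scaling, let `‖B‖ ≤ 1`. The elements `1 - (1 - B*B)ⁿ` increase, and their least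
upper bound is the projection `Q` onto `(ker B)ᗮ` (`isLUB_one_sub_pow`). Their images are bounded by
the projection `Q'` onto `(ker Φ(B))ᗮ`, so normality yields `Φ Q ≤ Q'`; if `ker B ≤ ker A` then
`A = A Q`, and so `Φ A = Φ A Φ Q` vanishes on `ker Φ(B)` (`ker_map_le`). Density of the range of `B`
is triviality of `ker B*`, so density statements are statements about null spaces. For closures, if
`A / B` has closure `A₁ / B₁` with `B = B₁ C`, then the density of one graph in the other is the
inclusion of `ker C*` in `ker Q₁`, where `Q₁` is the projection onto `(ker B₁)ᗮ`
(`closure_graph_opQuot_map`).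

*Membership.* A closed operator whose graph is invariant under the commutant is a quotient of
elements of `M` (`mem_affOps_of_invariant`). This applies to closures of affiliated operators and,
because a von Neumann algebra is spanned by its unitaries, to closed operators affiliated in the
sense of Murray and von Neumann.
-/

noncomputable section

open ContinuousLinearMap

/-! ### Douglas factorization of bounded operators -/

section Factorization

variable {E F G : Type*} [NormedAddCommGroup E] [InnerProductSpace ℂ E]
  [NormedAddCommGroup F] [InnerProductSpace ℂ F] [CompleteSpace F]
  [NormedAddCommGroup G] [InnerProductSpace ℂ G]

/-- Douglas factorization, majorization form: if `‖R x‖ ≤ c ‖V x‖` then `V x ↦ R x` extends to a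
bounded operator, canonically so if it is required to vanish on `(ran V)ᗮ`. -/
theorem exists_comp_eq_of_norm_le [CompleteSpace G] (V : E →L[ℂ] F) (R : E →L[ℂ] G) (c : ℝ)
    (h : ∀ x, ‖R x‖ ≤ c * ‖V x‖) :
    ∃ W : F →L[ℂ] G, (∀ x, W (V x) = R x) ∧
      ∀ z ∈ (LinearMap.range (V : E →ₗ[ℂ] F))ᗮ, W z = 0 := by
  set S := LinearMap.range (V : E →ₗ[ℂ] F) with hS
  have hker : LinearMap.ker (V : E →ₗ[ℂ] F) ≤ LinearMap.ker (R : E →ₗ[ℂ] G) := by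
    intro x hx
    have hx' : V x = 0 := hx
    have := h x
    rw [hx', norm_zero, mul_zero] at this
    exact norm_le_zero_iff.1 this
  let g₀ : S →ₗ[ℂ] G := (Submodule.liftQ _ (R : E →ₗ[ℂ] G) hker) ∘ₗ
    ((V : E →ₗ[ℂ] F).quotKerEquivRange.symm : S →ₗ[ℂ] _)
  have hg₀ : ∀ x (hx : V x ∈ S), g₀ ⟨V x, hx⟩ = R x := by
    intro x hx
    have := LinearMap.quotKerEquivRange_symm_apply_image (V : E →ₗ[ℂ] F) x hx
    simp only [g₀, LinearMap.comp_apply, LinearEquiv.coe_coe]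
    erw [this]
    simp
  let g : S →L[ℂ] G := g₀.mkContinuous c (by
    rintro ⟨_, x, rfl⟩
    exact (congrArg norm (hg₀ x _)).trans_le (h x))
  let ι : S →L[ℂ] S.topologicalClosure :=
    S.subtypeL.codRestrict S.topologicalClosure fun x => S.le_topologicalClosure x.2
  have hι : IsUniformInducing ι := by
    have : Isometry ι := fun x y => rfl
    exact this.isUniformInducing
  have hd : DenseRange ι := by
    intro y
    rw [Topology.IsInducing.subtypeVal.closure_eq_preimage_closure_image, Set.mem_preimage,
      ← Set.range_comp]
    have h1 : Set.range (Subtype.val ∘ ι) = (S : Set F) := by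
      ext z
      exact ⟨by rintro ⟨w, rfl⟩; exact w.2, fun hz => ⟨⟨z, hz⟩, rfl⟩⟩
    exact (congrArg closure h1).symm ▸ y.2
  refine ⟨(g.extend ι) ∘L S.topologicalClosure.orthogonalProjectionOnto, fun x => ?_, fun z hz => ?_⟩
  · have h1 : S.topologicalClosure.orthogonalProjectionOnto (V x) = ι ⟨V x, x, rfl⟩ :=
      Submodule.orthogonalProjectionOnto_mem_subspace_eq_self
        (⟨V x, S.le_topologicalClosure ⟨x, rfl⟩⟩ : S.topologicalClosure)
    rw [ContinuousLinearMap.comp_apply, h1, ContinuousLinearMap.extend_eq _ hd hι]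
    exact hg₀ x _
  · rw [ContinuousLinearMap.comp_apply,
      Submodule.orthogonalProjectionOnto_apply_of_mem_orthogonal, map_zero]
    rwa [Submodule.orthogonal_closure]

/-- Bounded operators agreeing on the range of `V` and on its orthogonal complement are equal. -/
theorem eq_of_eq_on_range_of_eq_on_orthogonal {V : E →L[ℂ] F} {W₁ W₂ : F →L[ℂ] G}
    (h : ∀ x, W₁ (V x) = W₂ (V x))
    (h' : ∀ z ∈ (LinearMap.range (V : E →ₗ[ℂ] F))ᗮ, W₁ z = W₂ z) : W₁ = W₂ := by
  set S := LinearMap.range (V : E →ₗ[ℂ] F) with hS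
  have hcl : ∀ y ∈ S.topologicalClosure, W₁ y = W₂ y := by
    intro y hy
    have : IsClosed {y | W₁ y = W₂ y} := isClosed_eq W₁.continuous W₂.continuous
    refine closure_minimal ?_ this hy
    rintro _ ⟨x, rfl⟩
    exact h x
  ext y
  have hy := S.topologicalClosure.sub_starProjection_mem_orthogonal y
  rw [Submodule.orthogonal_closure] at hy
  have h1 := h' _ hy
  have h2 := hcl _ (S.topologicalClosure.starProjection_apply_mem y)
  rw [map_sub, map_sub, h2] at h1
  exact sub_left_injective h1

/-- The canonical factor `W` of `R = W V` intertwines whatever `V` and `R` intertwine, provided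
that `V` intertwines the adjoints as well. -/
theorem factor_intertwines {V : E →L[ℂ] F} {R : E →L[ℂ] G} {W : F →L[ℂ] G}
    (hW : ∀ x, W (V x) = R x)
    (hW' : ∀ z ∈ (LinearMap.range (V : E →ₗ[ℂ] F))ᗮ, W z = 0)
    {d d' : E →L[ℂ] E} {e : F →L[ℂ] F} {f : G →L[ℂ] G}
    (hV : ∀ x, V (d x) = e (V x)) (hV' : ∀ x, V (d' x) = adjoint e (V x))
    (hR : ∀ x, R (d x) = f (R x)) (y : F) : W (e y) = f (W y) := by
  suffices h : W ∘L e = f ∘L W from DFunLike.congr_fun h y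
  refine eq_of_eq_on_range_of_eq_on_orthogonal (V := V) (fun x => ?_) fun z hz => ?_
  · simp only [ContinuousLinearMap.comp_apply]
    rw [← hV, hW, hW, hR]
  · simp only [ContinuousLinearMap.comp_apply]
    rw [hW' z hz, map_zero, hW']
    rw [Submodule.mem_orthogonal] at hz ⊢
    rintro _ ⟨x, rfl⟩
    rw [← adjoint_inner_left]
    exact hz _ ⟨d' x, hV' x⟩

/-- Douglas factorization, range form. The factor is pinned down by taking values in `(ker B)ᗮ`, and
its boundedness is an instance of the closed graph theorem. -/
theorem exists_comp_eq_of_range_le [CompleteSpace E] (A : E →L[ℂ] G) (B : F →L[ℂ] G)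
    (h : LinearMap.range (A : E →ₗ[ℂ] G) ≤ LinearMap.range (B : F →ₗ[ℂ] G)) :
    ∃ C : E →L[ℂ] F, (∀ x, B (C x) = A x) ∧
      ∀ x, C x ∈ (LinearMap.ker (B : F →ₗ[ℂ] G))ᗮ := by
  set N := LinearMap.ker (B : F →ₗ[ℂ] G) with hN
  have : CompleteSpace N := B.isClosed_ker.completeSpace_coe
  have hex : ∀ x, ∃ y, B y = A x ∧ y ∈ Nᗮ := by
    intro x
    obtain ⟨y, hy⟩ := h ⟨x, rfl⟩
    have hy' : B y = A x := hy
    refine ⟨y - N.starProjection y, ?_, N.sub_starProjection_mem_orthogonal y⟩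
    have : B (N.starProjection y) = 0 := N.starProjection_apply_mem y
    rw [map_sub, this, sub_zero, hy']
  choose f hf hf' using hex
  have huniq : ∀ y ∈ Nᗮ, B y = 0 → y = 0 := fun y hy hBy =>
    N.orthogonal_disjoint.le_bot ⟨hBy, hy⟩
  let C : E →ₗ[ℂ] F :=
    { toFun := f
      map_add' := fun x y => by
        refine sub_eq_zero.1 (huniq _ (Nᗮ.sub_mem (hf' _) (Nᗮ.add_mem (hf' _) (hf' _))) ?_)
        simp [hf]
      map_smul' := fun a x => by
        refine sub_eq_zero.1 (huniq _ (Nᗮ.sub_mem (hf' _) (Nᗮ.smul_mem _ (hf' _))) ?_)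
        simp [hf] }
  have hC : Continuous C := by
    refine C.continuous_of_seq_closed_graph fun u x y hu hy => ?_
    have hyN : y ∈ Nᗮ := N.isClosed_orthogonal.mem_of_tendsto hy
      (Filter.Eventually.of_forall fun n => hf' (u n))
    have h1 : Filter.Tendsto (fun n => B (f (u n))) Filter.atTop (nhds (B y)) :=
      (B.continuous.tendsto y).comp hy
    simp only [hf] at h1
    have h2 := tendsto_nhds_unique h1 ((A.continuous.tendsto x).comp hu)
    refine sub_eq_zero.1 (huniq _ (Nᗮ.sub_mem hyN (hf' x)) ?_)
    rw [map_sub, h2]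
    exact sub_eq_zero.2 (hf x).symm
  exact ⟨⟨C, hC⟩, hf, hf'⟩

/-- A bounded operator with closed range is bounded below modulo its kernel. -/
theorem exists_norm_le_of_isClosed_range {X : Type*} [NormedAddCommGroup X] [NormedSpace ℂ X]
    [CompleteSpace E] [CompleteSpace X] (V : E →L[ℂ] X)
    (hV : IsClosed (LinearMap.range (V : E →ₗ[ℂ] X) : Set X)) :
    ∃ c : ℝ, 0 ≤ c ∧ ∀ x ∈ (LinearMap.ker (V : E →ₗ[ℂ] X))ᗮ, ‖x‖ ≤ c * ‖V x‖ := by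
  have : CompleteSpace (LinearMap.range (V : E →ₗ[ℂ] X)) := hV.completeSpace_coe
  let V' : E →L[ℂ] LinearMap.range (V : E →ₗ[ℂ] X) := V.codRestrict _ fun x => ⟨x, rfl⟩
  have hsurj : Function.Surjective V' := by
    rintro ⟨_, x, rfl⟩
    exact ⟨x, rfl⟩
  obtain ⟨c, hc, h⟩ := V'.exists_preimage_norm_le hsurj
  refine ⟨c, hc.le, fun x hx => ?_⟩
  obtain ⟨y, hy, hyn⟩ := h (V' x)
  refine le_trans ?_ hyn
  have hk : y - x ∈ LinearMap.ker (V : E →ₗ[ℂ] X) := by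
    have : V y = V x := congrArg Subtype.val hy
    change V (y - x) = 0
    rw [map_sub, this, sub_self]
  -- `y = x + (y - x)` is an orthogonal decomposition
  have h0 : inner ℂ x (y - x) = 0 := Submodule.inner_left_of_mem_orthogonal hk hx
  have := norm_add_sq_eq_norm_sq_add_norm_sq_of_inner_eq_zero x (y - x) h0
  rw [add_sub_cancel] at this
  exact le_of_sq_le_sq (by nlinarith [norm_nonneg (y - x)]) (norm_nonneg y)

end Factorization

/-! ### Factorization and supports inside a von Neumann algebra -/

section Factors

variable {H : Type*} [NormedAddCommGroup H] [InnerProductSpace ℂ H] [CompleteSpace H]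
variable {M : VonNeumannAlgebra H}

/-- The double commutant property, pointwise. -/
theorem mem_of_commutes {C : H →L[ℂ] H} (h : ∀ D ∈ M.commutant, ∀ x, C (D x) = D (C x)) :
    C ∈ M.toStarSubalgebra := by
  have : C ∈ M.commutant.commutant := VonNeumannAlgebra.mem_commutant_iff.2 fun D hD =>
    ContinuousLinearMap.ext fun x => (h D hD x).symm
  rwa [VonNeumannAlgebra.commutant_commutant] at this

theorem commutes_commutant (A : M.toStarSubalgebra) {D : H →L[ℂ] H} (hD : D ∈ M.commutant)
    (x : H) : (A : H →L[ℂ] H) (D x) = D ((A : H →L[ℂ] H) x) :=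
  DFunLike.congr_fun (VonNeumannAlgebra.mem_commutant_iff.1 hD A A.2) x

theorem adjoint_mem_commutant {D : H →L[ℂ] H} (hD : D ∈ M.commutant) :
    adjoint D ∈ M.commutant :=
  star_mem hD

theorem exists_mul_eq_of_range_le (A B : M.toStarSubalgebra)
    (h : LinearMap.range ((A : H →L[ℂ] H) : H →ₗ[ℂ] H) ≤
      LinearMap.range ((B : H →L[ℂ] H) : H →ₗ[ℂ] H)) :
    ∃ C : M.toStarSubalgebra, B * C = A ∧
      ∀ x, (C : H →L[ℂ] H) x ∈ (LinearMap.ker ((B : H →L[ℂ] H) : H →ₗ[ℂ] H))ᗮ := by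
  obtain ⟨C, hC, hC'⟩ := exists_comp_eq_of_range_le (A : H →L[ℂ] H) (B : H →L[ℂ] H) h
  refine ⟨⟨C, mem_of_commutes fun D hD x => ?_⟩, Subtype.ext (ContinuousLinearMap.ext hC), hC'⟩
  set N := LinearMap.ker ((B : H →L[ℂ] H) : H →ₗ[ℂ] H) with hN
  -- `D` preserves `(ker B)ᗮ` because its adjoint preserves `ker B`
  have hDC : D (C x) ∈ Nᗮ := by
    rw [Submodule.mem_orthogonal]
    intro z hz
    rw [← adjoint_inner_left]
    refine (Submodule.mem_orthogonal _ _).1 (hC' x) _ ?_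
    have hz' : (B : H →L[ℂ] H) z = 0 := hz
    change (B : H →L[ℂ] H) (adjoint D z) = 0
    rw [commutes_commutant B (adjoint_mem_commutant hD), hz', map_zero]
  have hker : C (D x) - D (C x) ∈ N := by
    change (B : H →L[ℂ] H) (C (D x) - D (C x)) = 0
    rw [map_sub, hC, commutes_commutant B hD, hC, commutes_commutant A hD, sub_self]
  exact sub_eq_zero.1 (N.orthogonal_disjoint.le_bot ⟨hker, Nᗮ.sub_mem (hC' _) hDC⟩)

theorem exists_mul_eq_of_norm_le (A B : M.toStarSubalgebra) (c : ℝ)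
    (h : ∀ x, ‖(A : H →L[ℂ] H) x‖ ≤ c * ‖(B : H →L[ℂ] H) x‖) :
    ∃ W : M.toStarSubalgebra, W * B = A := by
  obtain ⟨W, hW, hW'⟩ := exists_comp_eq_of_norm_le (B : H →L[ℂ] H) (A : H →L[ℂ] H) c h
  refine ⟨⟨W, mem_of_commutes fun D hD x => ?_⟩, Subtype.ext (ContinuousLinearMap.ext hW)⟩
  exact factor_intertwines hW hW' (commutes_commutant B hD)
    (commutes_commutant B (adjoint_mem_commutant hD)) (commutes_commutant A hD) x

/-- The right support of `B`: the projection onto `(ker B)ᗮ`, as an element of the algebra. -/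
def rightSupport (B : M.toStarSubalgebra) : M.toStarSubalgebra :=
  ⟨(LinearMap.ker ((B : H →L[ℂ] H) : H →ₗ[ℂ] H))ᗮ.starProjection, by
    refine (VonNeumannAlgebra.IsStarProjection.mem_iff isStarProjection_starProjection M).2
      fun D hD => ?_
    rw [Submodule.range_starProjection]
    intro x hx
    change D x ∈ (LinearMap.ker ((B : H →L[ℂ] H) : H →ₗ[ℂ] H))ᗮ
    rw [Submodule.mem_orthogonal] at hx ⊢
    intro z hz
    rw [← adjoint_inner_left]
    refine hx _ ?_
    have hz' : (B : H →L[ℂ] H) z = 0 := hz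
    change (B : H →L[ℂ] H) (adjoint D z) = 0
    rw [commutes_commutant B (adjoint_mem_commutant hD), hz', map_zero]⟩

theorem rightSupport_apply_mem (B : M.toStarSubalgebra) (x : H) :
    (rightSupport B : H →L[ℂ] H) x ∈ (LinearMap.ker ((B : H →L[ℂ] H) : H →ₗ[ℂ] H))ᗮ :=
  Submodule.starProjection_apply_mem _ x

theorem rightSupport_apply_eq_self (B : M.toStarSubalgebra) {x : H}
    (hx : x ∈ (LinearMap.ker ((B : H →L[ℂ] H) : H →ₗ[ℂ] H))ᗮ) :
    (rightSupport B : H →L[ℂ] H) x = x :=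
  Submodule.starProjection_eq_self_iff.2 hx

theorem sub_rightSupport_apply_mem (B : M.toStarSubalgebra) (x : H) :
    x - (rightSupport B : H →L[ℂ] H) x ∈ LinearMap.ker ((B : H →L[ℂ] H) : H →ₗ[ℂ] H) := by
  have hcl : IsClosed (LinearMap.ker ((B : H →L[ℂ] H) : H →ₗ[ℂ] H) : Set H) :=
    (B : H →L[ℂ] H).isClosed_ker
  have := Submodule.sub_starProjection_mem_orthogonal
    (K := (LinearMap.ker ((B : H →L[ℂ] H) : H →ₗ[ℂ] H))ᗮ) x
  rwa [Submodule.orthogonal_orthogonal_eq_closure, hcl.submodule_topologicalClosure_eq] at this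

theorem rightSupport_apply_eq_zero (B : M.toStarSubalgebra) {x : H}
    (hx : (B : H →L[ℂ] H) x = 0) : (rightSupport B : H →L[ℂ] H) x = 0 := by
  have h := sub_rightSupport_apply_mem B x
  have h' : (rightSupport B : H →L[ℂ] H) x ∈ LinearMap.ker ((B : H →L[ℂ] H) : H →ₗ[ℂ] H) := by
    have := Submodule.sub_mem _ (show x ∈ LinearMap.ker ((B : H →L[ℂ] H) : H →ₗ[ℂ] H) from hx) h
    rwa [sub_sub_cancel] at this
  exact (Submodule.orthogonal_disjoint _).le_bot ⟨h', rightSupport_apply_mem B x⟩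

theorem star_rightSupport (B : M.toStarSubalgebra) : star (rightSupport B) = rightSupport B :=
  Subtype.ext (isStarProjection_starProjection.isSelfAdjoint.star_eq)

theorem mul_rightSupport_of_ker_le {A B : M.toStarSubalgebra}
    (h : LinearMap.ker ((B : H →L[ℂ] H) : H →ₗ[ℂ] H) ≤
      LinearMap.ker ((A : H →L[ℂ] H) : H →ₗ[ℂ] H)) : A * rightSupport B = A := by
  refine Subtype.ext (ContinuousLinearMap.ext fun x => ?_)
  have := h (sub_rightSupport_apply_mem B x)
  have h2 : (A : H →L[ℂ] H) (x - (rightSupport B : H →L[ℂ] H) x) = 0 := this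
  rw [map_sub, sub_eq_zero] at h2
  exact h2.symm

end Factors

section Columns

variable {H : Type*} [NormedAddCommGroup H] [InnerProductSpace ℂ H]

/-- The column operator `x ↦ (B x, A x)` into the Hilbert sum `H ⊕ H`. The denominator of `A / B`
comes first, so that the range of `column A B` is the graph of `A / B`. -/
def column (A B : H →L[ℂ] H) : H →L[ℂ] WithLp 2 (H × H) :=
  ((WithLp.prodContinuousLinearEquiv 2 ℂ H H).symm : H × H →L[ℂ] WithLp 2 (H × H)) ∘L (B.prod A)

@[simp] theorem column_fst (A B : H →L[ℂ] H) (x : H) : (column A B x).fst = B x := rfl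
@[simp] theorem column_snd (A B : H →L[ℂ] H) (x : H) : (column A B x).snd = A x := rfl

/-- The diagonal operator `D ⊕ D` on the Hilbert sum `H ⊕ H`. -/
def diagonal (D : H →L[ℂ] H) : WithLp 2 (H × H) →L[ℂ] WithLp 2 (H × H) :=
  ((WithLp.prodContinuousLinearEquiv 2 ℂ H H).symm : H × H →L[ℂ] WithLp 2 (H × H)) ∘L
    (D.prodMap D) ∘L ((WithLp.prodContinuousLinearEquiv 2 ℂ H H) : _ →L[ℂ] H × H)

@[simp] theorem diagonal_fst (D : H →L[ℂ] H) (x) : (diagonal D x).fst = D x.fst := rfl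
@[simp] theorem diagonal_snd (D : H →L[ℂ] H) (x) : (diagonal D x).snd = D x.snd := rfl

theorem withLp_prod_ext {X : Type*} {x y : WithLp 2 (X × X)} (h₁ : x.fst = y.fst)
    (h₂ : x.snd = y.snd) : x = y :=
  WithLp.ofLp_injective 2 (Prod.ext h₁ h₂)

theorem adjoint_diagonal [CompleteSpace H] (D : H →L[ℂ] H) :
    adjoint (diagonal D) = diagonal (adjoint D) := by
  symm
  rw [eq_adjoint_iff]
  intro x y
  simp [WithLp.prod_inner_apply, adjoint_inner_left]

variable [CompleteSpace H] {M : VonNeumannAlgebra H}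

theorem column_commutes (A B : M.toStarSubalgebra) {D : H →L[ℂ] H} (hD : D ∈ M.commutant)
    (x : H) : column (A : H →L[ℂ] H) (B : H →L[ℂ] H) (D x) =
      diagonal D (column (A : H →L[ℂ] H) (B : H →L[ℂ] H) x) :=
  withLp_prod_ext (commutes_commutant B hD x) (commutes_commutant A hD x)

/-- If the graph `{(B x, A x)}` is closed, then `(B, A)` is bounded below on `(ker B)ᗮ`, and so it
has a left inverse `(D₁, D₂)` there with entries in the algebra. -/
theorem exists_left_inverse_of_isClosed {A B : M.toStarSubalgebra}
    (h : LinearMap.ker ((B : H →L[ℂ] H) : H →ₗ[ℂ] H) ≤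
      LinearMap.ker ((A : H →L[ℂ] H) : H →ₗ[ℂ] H))
    (hcl : IsClosed (LinearMap.range (((B : H →L[ℂ] H) : H →ₗ[ℂ] H).prod
      ((A : H →L[ℂ] H) : H →ₗ[ℂ] H)) : Set (H × H))) :
    ∃ D₁ D₂ : M.toStarSubalgebra, D₁ * B + D₂ * A = rightSupport B := by
  obtain ⟨c, hc, hb⟩ := exists_norm_le_of_isClosed_range
    ((B : H →L[ℂ] H).prod (A : H →L[ℂ] H)) hcl
  have hb' : ∀ x, ‖(rightSupport B : H →L[ℂ] H) x‖ ≤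
      c * ‖column (A : H →L[ℂ] H) (B : H →L[ℂ] H) x‖ := by
    intro x
    set y := (rightSupport B : H →L[ℂ] H) x with hy
    have hBy : (B : H →L[ℂ] H) y = (B : H →L[ℂ] H) x :=
      DFunLike.congr_fun (congrArg Subtype.val (mul_rightSupport_of_ker_le (le_refl _))) x
    have hAy : (A : H →L[ℂ] H) y = (A : H →L[ℂ] H) x :=
      DFunLike.congr_fun (congrArg Subtype.val (mul_rightSupport_of_ker_le h)) x
    have hker : LinearMap.ker (((B : H →L[ℂ] H).prod (A : H →L[ℂ] H) : H →L[ℂ] H × H) :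
        H →ₗ[ℂ] H × H) ≤ LinearMap.ker ((B : H →L[ℂ] H) : H →ₗ[ℂ] H) := fun z hz =>
      (Prod.ext_iff.1 (show ((B : H →L[ℂ] H) z, (A : H →L[ℂ] H) z) = 0 from hz)).1
    refine (hb y (Submodule.orthogonal_le hker (rightSupport_apply_mem B x))).trans ?_
    refine mul_le_mul_of_nonneg_left ?_ hc
    rw [ContinuousLinearMap.prod_apply, hBy, hAy, Prod.norm_def, max_le_iff]
    have hn := WithLp.prod_norm_sq_eq_of_L2 (column (A : H →L[ℂ] H) (B : H →L[ℂ] H) x)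
    simp only [column_fst, column_snd] at hn
    constructor <;> refine le_of_sq_le_sq ?_ (norm_nonneg _) <;> rw [hn]
    · exact le_add_of_nonneg_right (sq_nonneg _)
    · exact le_add_of_nonneg_left (sq_nonneg _)
  obtain ⟨W, hW, hW'⟩ := exists_comp_eq_of_norm_le _ _ c hb'
  have hcomm : ∀ D ∈ M.commutant, ∀ z, W (diagonal D z) = D (W z) := fun D hD z =>
    factor_intertwines hW hW' (column_commutes A B hD)
      (fun x => by
        rw [adjoint_diagonal]; exact column_commutes A B (adjoint_mem_commutant hD) x)
      (commutes_commutant (rightSupport B) hD) z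
  refine ⟨⟨W ∘L column 0 1, mem_of_commutes fun D hD x => ?_⟩,
    ⟨W ∘L column 1 0, mem_of_commutes fun D hD x => ?_⟩, ?_⟩
  · rw [ContinuousLinearMap.comp_apply, ContinuousLinearMap.comp_apply, ← hcomm D hD]
    exact congrArg W (withLp_prod_ext (by simp) (by simp))
  · rw [ContinuousLinearMap.comp_apply, ContinuousLinearMap.comp_apply, ← hcomm D hD]
    exact congrArg W (withLp_prod_ext (by simp) (by simp))
  · refine Subtype.ext (ContinuousLinearMap.ext fun x => ?_)
    rw [← hW x]
    change W (column 0 1 ((B : H →L[ℂ] H) x)) + W (column 1 0 ((A : H →L[ℂ] H) x)) = _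
    rw [← map_add]
    exact congrArg W (withLp_prod_ext (by simp) (by simp))

end Columns

/-! ### Normality and null spaces -/

section Normality

variable {H : Type*} [NormedAddCommGroup H] [InnerProductSpace ℂ H] [CompleteSpace H]
variable {M : VonNeumannAlgebra H}

theorem le_of_sub_eq_star_mul_self {A B C : M.toStarSubalgebra} (h : B - A = star C * C) :
    A ≤ B := by
  have : (0 : H →L[ℂ] H) ≤ (B : H →L[ℂ] H) - (A : H →L[ℂ] H) := by
    have h' : (B : H →L[ℂ] H) - (A : H →L[ℂ] H) = star (C : H →L[ℂ] H) * (C : H →L[ℂ] H) :=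
      congrArg Subtype.val h
    rw [h']
    exact star_mul_self_nonneg _
  exact sub_nonneg.1 this

theorem sqrt_mem {T : H →L[ℂ] H} (hT : T ∈ M.toStarSubalgebra) :
    CFC.sqrt T ∈ M.toStarSubalgebra := by
  refine mem_of_commutes fun D hD x => ?_
  have hc : Commute T D := ContinuousLinearMap.ext fun y => commutes_commutant ⟨T, hT⟩ hD y
  exact DFunLike.congr_fun (hc.cfcₙ_nnreal NNReal.sqrt).eq x

/-- The square root makes `1 - B*B` the square of a self-adjoint element, so that positivity of its
powers passes through a homomorphism without an appeal to order. -/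
theorem exists_sqrt_one_sub {B : M.toStarSubalgebra} (hB : ‖(B : H →L[ℂ] H)‖ ≤ 1) :
    ∃ s : M.toStarSubalgebra, star s = s ∧ s * s = 1 - star B * B := by
  set T : H →L[ℂ] H := 1 - star (B : H →L[ℂ] H) * (B : H →L[ℂ] H) with hT
  have hT0 : 0 ≤ T := by
    refine sub_nonneg.2 ((CStarAlgebra.norm_le_one_iff_of_nonneg _ (star_mul_self_nonneg _)).1 ?_)
    rw [CStarRing.norm_star_mul_self]
    exact mul_le_one₀ hB (norm_nonneg _) hB
  have hTM : T ∈ M.toStarSubalgebra := (1 - star B * B : M.toStarSubalgebra).2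
  refine ⟨⟨CFC.sqrt T, sqrt_mem hTM⟩, ?_, ?_⟩
  · exact Subtype.ext (IsSelfAdjoint.of_nonneg (CFC.sqrt_nonneg T)).star_eq
  · exact Subtype.ext (CFC.sqrt_mul_sqrt_self T hT0)

variable {B s : M.toStarSubalgebra}

/-- With `Q` the right support of `B`, the operator `c = s * s` fixes `ker B`, and therefore
`Q - (1 - cⁿ) = Q cⁿ Q` is positive. -/
theorem one_sub_pow_le_rightSupport (hs : star s = s) (hsB : s * s = 1 - star B * B) (n : ℕ) :
    1 - (s * s) ^ n ≤ rightSupport B := by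
  set Q := rightSupport B with hQ
  have hBQ : B * Q = B := mul_rightSupport_of_ker_le le_rfl
  have hQQ : Q * Q = Q := Subtype.ext (isStarProjection_starProjection.isIdempotentElem)
  have hQs : star Q = Q := star_rightSupport B
  have hQB : Q * star B = star B := by
    have := congrArg star hBQ
    rwa [star_mul, hQs] at this
  have h1 : s * s * (1 - Q) = 1 - Q := by
    rw [hsB, sub_mul, one_mul, mul_assoc, mul_sub, hBQ, mul_one, sub_self, mul_zero, sub_zero]
  have h2 : (1 - Q) * (s * s) = 1 - Q := by
    rw [hsB, mul_sub, mul_one, ← mul_assoc, sub_mul, hQB, one_mul, sub_self, zero_mul, sub_zero]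
  have h3 : (s * s) ^ n * (1 - Q) = 1 - Q := by
    induction n with
    | zero => rw [pow_zero, one_mul]
    | succ n ih => rw [pow_succ, mul_assoc, h1, ih]
  have h4 : (1 - Q) * (s * s) ^ n = 1 - Q := by
    clear h3
    induction n with
    | zero => rw [pow_zero, mul_one]
    | succ n ih => rw [pow_succ, ← mul_assoc, ih, h2]
  have hpow : star (s ^ n) * s ^ n = (s * s) ^ n := by
    rw [star_pow, hs, (Commute.refl s).mul_pow]
  refine le_of_sub_eq_star_mul_self (C := s ^ n * Q) ?_
  rw [star_mul, hQs, mul_assoc, ← mul_assoc _ _ Q, hpow]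
  have h5 : (s * s) ^ n * Q = (s * s) ^ n - (1 - Q) := by
    rw [← h3, mul_sub, mul_one, sub_sub_cancel]
  have h6 : Q * (s * s) ^ n = (s * s) ^ n - (1 - Q) := by
    rw [← h4, sub_mul, one_mul, sub_sub_cancel]
  rw [h5, mul_sub, h6, mul_sub, mul_one, hQQ, sub_self, sub_zero]
  abel

theorem monotone_one_sub_pow (hs : star s = s) (hsB : s * s = 1 - star B * B) :
    Monotone fun n : ℕ => 1 - (s * s) ^ n := by
  refine monotone_nat_of_le_succ fun n => le_of_sub_eq_star_mul_self (C := B * s ^ n) ?_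
  have hT : star B * B = 1 - s * s := by rw [hsB, sub_sub_cancel]
  rw [star_mul, star_pow, hs, mul_assoc, ← mul_assoc (star B), hT, sub_mul, one_mul, mul_sub,
    ← (Commute.refl s).mul_pow, ← mul_assoc, ← mul_assoc, ← pow_succ, mul_assoc, ← pow_succ',
    ← (Commute.refl s).mul_pow]
  abel

/-- The elements `1 - (1 - B*B)ⁿ` have the projection onto `(ker B)ᗮ` as least upper bound. An upper
bound of them is an upper bound of their averages, and by the mean ergodic theorem the averages
of `(1 - B*B)ⁿ` converge strongly to the projection onto the fixed space of `1 - B*B`, which is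
`ker B`. -/
theorem isLUB_one_sub_pow (hs : star s = s) (hsB : s * s = 1 - star B * B) :
    IsLUB (Set.range fun n : ℕ => 1 - (s * s) ^ n) (rightSupport B) := by
  refine ⟨by rintro _ ⟨n, rfl⟩; exact one_sub_pow_le_rightSupport hs hsB n, fun S hS => ?_⟩
  have hS' : ∀ n, (1 : H →L[ℂ] H) - ((s : H →L[ℂ] H) * (s : H →L[ℂ] H)) ^ n ≤ (S : H →L[ℂ] H) :=
    fun n => hS ⟨n, rfl⟩
  set f : H →L[ℂ] H := (s : H →L[ℂ] H) * (s : H →L[ℂ] H) with hf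
  have hfB : f = 1 - star (B : H →L[ℂ] H) * (B : H →L[ℂ] H) := congrArg Subtype.val hsB
  have hs' : star (s : H →L[ℂ] H) = (s : H →L[ℂ] H) := congrArg Subtype.val hs
  have hf0 : 0 ≤ f := by
    have := star_mul_self_nonneg (s : H →L[ℂ] H)
    rwa [hs'] at this
  have hf1 : ‖f‖ ≤ 1 := by
    rw [CStarAlgebra.norm_le_one_iff_of_nonneg f hf0, hfB]
    exact sub_le_self _ (star_mul_self_nonneg _)
  have hS0 : 0 ≤ (S : H →L[ℂ] H) := by
    have := hS' 0
    rwa [pow_zero, sub_self] at this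
  have hfix : f.eqLocus (1 : H →L[ℂ] H) = LinearMap.ker ((B : H →L[ℂ] H) : H →ₗ[ℂ] H) := by
    ext x
    have h1 : f x = x - adjoint (B : H →L[ℂ] H) ((B : H →L[ℂ] H) x) := by rw [hfB]; rfl
    constructor
    · intro hx
      have hx' : f x = x := hx
      rw [h1, sub_eq_self] at hx'
      have h2 : inner ℂ ((B : H →L[ℂ] H) x) ((B : H →L[ℂ] H) x) = 0 := by
        rw [← adjoint_inner_left, hx', inner_zero_left]
      exact inner_self_eq_zero.1 h2
    · intro hx
      have hx' : (B : H →L[ℂ] H) x = 0 := hx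
      change f x = x
      rw [h1, hx', map_zero, sub_zero]
  have hQ : ∀ x, (((f.eqLocus (1 : H →L[ℂ] H)).orthogonalProjectionOnto x : _) : H) =
      x - (rightSupport B : H →L[ℂ] H) x := by
    intro x
    rw [Submodule.coe_orthogonalProjectionOnto_apply]
    refine Submodule.eq_starProjection_of_mem_orthogonal ?_ ?_ <;> rw [hfix]
    · exact sub_rightSupport_apply_mem B x
    · rw [sub_sub_cancel]
      exact rightSupport_apply_mem B x
  have hQs : IsSelfAdjoint (rightSupport B : H →L[ℂ] H) :=
    isStarProjection_starProjection.isSelfAdjoint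
  change (rightSupport B : H →L[ℂ] H) ≤ (S : H →L[ℂ] H)
  rw [ContinuousLinearMap.le_def, ContinuousLinearMap.isPositive_def']
  refine ⟨(IsSelfAdjoint.of_nonneg hS0).sub hQs, fun x => ?_⟩
  have hlim := f.tendsto_birkhoffAverage_orthogonalProjection hf1 x
  rw [hQ x] at hlim
  have hlim2 : Filter.Tendsto
      (fun n : ℕ => (inner ℂ (x - birkhoffAverage ℂ f _root_.id n x) x : ℂ).re) Filter.atTop
      (nhds (inner ℂ ((rightSupport B : H →L[ℂ] H) x) x : ℂ).re) := by
    have h1 := ((tendsto_const_nhds (x := x)).sub hlim).inner (𝕜 := ℂ) (tendsto_const_nhds (x := x))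
    rw [sub_sub_cancel] at h1
    exact (Complex.continuous_re.tendsto _).comp h1
  have hle : (inner ℂ ((rightSupport B : H →L[ℂ] H) x) x : ℂ).re ≤
      (inner ℂ ((S : H →L[ℂ] H) x) x : ℂ).re := by
    refine le_of_tendsto hlim2 ?_
    filter_upwards [Filter.eventually_gt_atTop 0] with n hn
    -- each term `x - f ^ k x` of the average satisfies the bound
    have hk : ∀ k, (inner ℂ x x : ℂ).re - (inner ℂ ((S : H →L[ℂ] H) x) x : ℂ).re ≤
        (inner ℂ (f^[k] x) x : ℂ).re := by
      intro k
      have h1 := (ContinuousLinearMap.isPositive_def'.1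
        ((ContinuousLinearMap.le_def _ _).1 (hS' k))).2 x
      rw [ContinuousLinearMap.reApplyInnerSelf_apply] at h1
      simp only [sub_apply, one_apply_eq_self, inner_sub_left,
        map_sub, FunLike.coe_pow_eq_iterate] at h1
      simp only [RCLike.re_to_complex] at h1
      linarith
    have hsum : n * ((inner ℂ x x : ℂ).re - (inner ℂ ((S : H →L[ℂ] H) x) x : ℂ).re) ≤
        (inner ℂ (birkhoffSum f _root_.id n x) x : ℂ).re := by
      rw [birkhoffSum, sum_inner, Complex.re_sum]
      have := Finset.card_nsmul_le_sum (Finset.range n) _ _ fun k _ => hk k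
      rwa [Finset.card_range, nsmul_eq_mul] at this
    have hn' : (0 : ℝ) < n := Nat.cast_pos.2 hn
    have havg : (inner ℂ (birkhoffAverage ℂ f _root_.id n x) x : ℂ).re =
        (n : ℝ)⁻¹ * (inner ℂ (birkhoffSum f _root_.id n x) x : ℂ).re := by
      have hc : ((n : ℂ))⁻¹ = (((n : ℝ)⁻¹ : ℝ) : ℂ) := by push_cast; rfl
      rw [birkhoffAverage, inner_smul_left, hc, Complex.conj_ofReal, Complex.re_ofReal_mul]
    rw [inner_sub_left, Complex.sub_re, havg]
    have h2 := mul_le_mul_of_nonneg_left hsum (inv_nonneg.2 hn'.le)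
    rw [← mul_assoc, inv_mul_cancel₀ hn'.ne', one_mul] at h2
    linarith
  rw [ContinuousLinearMap.reApplyInnerSelf_apply, sub_apply, inner_sub_left,
    map_sub]
  exact sub_nonneg.2 hle

variable {K : Type*} [NormedAddCommGroup K] [InnerProductSpace ℂ K] [CompleteSpace K]
variable {N : VonNeumannAlgebra K} {Φ : M.toStarSubalgebra →⋆ₐ[ℂ] N.toStarSubalgebra}

/-- Normality bounds the projection `Φ Q`, for `Q` the right support of `B`, by the right support of
`Φ B`, which vanishes on the null space of `Φ B`. -/
theorem map_rightSupport_apply_eq_zero_of_norm_le_one (hΦ : IsNormalHom Φ)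
    (hB : ‖(B : H →L[ℂ] H)‖ ≤ 1) {y : K} (hy : (Φ B : K →L[ℂ] K) y = 0) :
    (Φ (rightSupport B) : K →L[ℂ] K) y = 0 := by
  obtain ⟨s, hs, hsB⟩ := exists_sqrt_one_sub hB
  have hlub := hΦ _ _ (Set.range_nonempty _)
    (directedOn_range.2 (monotone_one_sub_pow hs hsB).directed_le)
    (by
      rintro _ ⟨n, rfl⟩
      have : star (s * s) = s * s := by rw [star_mul, hs]
      exact (IsSelfAdjoint.one _).sub (IsSelfAdjoint.pow this n))
    (isLUB_one_sub_pow hs hsB)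
  have hle : Φ (rightSupport B) ≤ rightSupport (Φ B) := by
    refine hlub.2 ?_
    rintro _ ⟨_, ⟨n, rfl⟩, rfl⟩
    have h := one_sub_pow_le_rightSupport (B := Φ B) (s := Φ s) (by rw [← map_star, hs])
      (by rw [← map_mul, hsB, map_sub, map_one, map_mul, map_star]) n
    rwa [← map_mul, ← map_pow, ← map_one Φ, ← map_sub] at h
  set Q := Φ (rightSupport B) with hQ
  have hQQ : star Q * Q = Q := by
    rw [hQ, ← map_star, star_rightSupport, ← map_mul]
    exact congrArg Φ (Subtype.ext isStarProjection_starProjection.isIdempotentElem)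
  have hle' : (Q : K →L[ℂ] K) ≤ (rightSupport (Φ B) : K →L[ℂ] K) := hle
  have h1 := (ContinuousLinearMap.isPositive_def'.1
    ((ContinuousLinearMap.le_def _ _).1 hle')).2 y
  rw [ContinuousLinearMap.reApplyInnerSelf_apply, sub_apply,
    rightSupport_apply_eq_zero _ hy, zero_sub, inner_neg_left] at h1
  have h2 : (Q : K →L[ℂ] K) y = adjoint (Q : K →L[ℂ] K) ((Q : K →L[ℂ] K) y) :=
    (DFunLike.congr_fun (congrArg Subtype.val hQQ) y).symm
  rw [h2, adjoint_inner_left, map_neg, inner_self_eq_norm_sq] at h1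
  have h3 : ‖(Q : K →L[ℂ] K) y‖ ^ 2 = 0 := le_antisymm (by linarith) (sq_nonneg _)
  exact norm_eq_zero.1 (pow_eq_zero_iff two_ne_zero |>.1 h3)

/-- A normal homomorphism preserves inclusions between null spaces. -/
theorem ker_map_le (hΦ : IsNormalHom Φ) {A B : M.toStarSubalgebra}
    (h : LinearMap.ker ((B : H →L[ℂ] H) : H →ₗ[ℂ] H) ≤
      LinearMap.ker ((A : H →L[ℂ] H) : H →ₗ[ℂ] H)) :
    LinearMap.ker ((Φ B : K →L[ℂ] K) : K →ₗ[ℂ] K) ≤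
      LinearMap.ker ((Φ A : K →L[ℂ] K) : K →ₗ[ℂ] K) := by
  intro y hy
  have hy' : (Φ B : K →L[ℂ] K) y = 0 := hy
  -- `r • B` is a contraction with the same null space as `B`
  set r : ℝ := (‖(B : H →L[ℂ] H)‖ + 1)⁻¹ with hr
  have hpos : 0 < ‖(B : H →L[ℂ] H)‖ + 1 := by positivity
  have hr0 : 0 < r := inv_pos.2 hpos
  set B' : M.toStarSubalgebra := (r : ℂ) • B with hB'
  have hnorm : ‖(B' : H →L[ℂ] H)‖ ≤ 1 := by
    change ‖(r : ℂ) • (B : H →L[ℂ] H)‖ ≤ 1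
    rw [norm_smul, Complex.norm_real, Real.norm_of_nonneg hr0.le, hr, inv_mul_le_one₀ hpos]
    exact le_add_of_nonneg_right zero_le_one
  have hker : LinearMap.ker ((B' : H →L[ℂ] H) : H →ₗ[ℂ] H) ≤
      LinearMap.ker ((A : H →L[ℂ] H) : H →ₗ[ℂ] H) := by
    intro x hx
    have hx' : (r : ℂ) • (B : H →L[ℂ] H) x = 0 := hx
    exact h ((smul_eq_zero.1 hx').resolve_left (Complex.ofReal_ne_zero.2 hr0.ne'))
  have h0 : (Φ B' : K →L[ℂ] K) y = 0 := by
    rw [hB', map_smul]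
    change (r : ℂ) • (Φ B : K →L[ℂ] K) y = 0
    rw [hy', smul_zero]
  have h1 := map_rightSupport_apply_eq_zero_of_norm_le_one hΦ hnorm h0
  change (Φ A : K →L[ℂ] K) y = 0
  rw [← mul_rightSupport_of_ker_le hker, map_mul]
  change (Φ A : K →L[ℂ] K) ((Φ (rightSupport B') : K →L[ℂ] K) y) = 0
  rw [h1, map_zero]

end Normality

/-! ### Operators with graph invariant under the commutant -/

section Invariance

variable {H : Type*} [NormedAddCommGroup H] [InnerProductSpace ℂ H]

/-- The bounded operators `D` such that `D ⊕ D` maps the subspace `𝒢` of `H × H` into itself. -/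
def graphStabilizer (𝒢 : Submodule ℂ (H × H)) : Submodule ℂ (H →L[ℂ] H) where
  carrier := {D | ∀ x ∈ 𝒢, (D x.1, D x.2) ∈ 𝒢}
  add_mem' := fun hC hD x hx => 𝒢.add_mem (hC x hx) (hD x hx)
  zero_mem' := fun _ _ => 𝒢.zero_mem
  smul_mem' := fun c _ hD x hx => 𝒢.smul_mem c (hD x hx)

theorem mem_graphStabilizer_topologicalClosure {𝒢 : Submodule ℂ (H × H)} {D : H →L[ℂ] H}
    (hD : D ∈ graphStabilizer 𝒢) : D ∈ graphStabilizer 𝒢.topologicalClosure := by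
  intro x hx
  have hmaps : Set.MapsTo (D.prodMap D) (𝒢 : Set (H × H)) 𝒢 := fun y hy => hD y hy
  exact hmaps.closure (D.prodMap D).continuous hx

theorem opQuot_eq_of_range_eq_graph {T : H →ₗ.[ℂ] H} {A B : H →L[ℂ] H}
    (h : LinearMap.range ((B : H →ₗ[ℂ] H).prod (A : H →ₗ[ℂ] H)) = T.graph) :
    LinearMap.ker (B : H →ₗ[ℂ] H) ≤ LinearMap.ker (A : H →ₗ[ℂ] H) ∧ T = opQuot A B := by
  have hker : LinearMap.ker (B : H →ₗ[ℂ] H) ≤ LinearMap.ker (A : H →ₗ[ℂ] H) := by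
    intro x hx
    have hmem : (B x, A x) ∈ T.graph := h ▸ ⟨x, rfl⟩
    exact T.graph_fst_eq_zero_snd hmem hx
  exact ⟨hker, LinearPMap.eq_of_eq_graph (by rw [opQuot_graph hker, h])⟩

variable [CompleteSpace H] {M : VonNeumannAlgebra H}

/-- A von Neumann algebra is spanned by its unitaries, so a subspace of operators that contains
the unitaries of the algebra contains the algebra. -/
theorem mem_of_unitary_mem {S : Submodule ℂ (H →L[ℂ] H)}
    (hS : ∀ U ∈ M, U ∈ unitary (H →L[ℂ] H) → U ∈ S) {D : H →L[ℂ] H} (hD : D ∈ M) : D ∈ S := by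
  have hcontr : ∀ a ∈ M.toStarSubalgebra, IsSelfAdjoint a → ‖a‖ ≤ 1 → a ∈ S := by
    intro a ha hsa hn
    -- `U` is a unitary with real part `a`
    set U := a + Complex.I • CFC.sqrt (1 - a ^ 2) with hU
    have hUu : U ∈ unitary (H →L[ℂ] H) := hsa.self_add_I_smul_cfcSqrt_sub_sq_mem_unitary a hn
    have hUM : U ∈ M.toStarSubalgebra :=
      add_mem ha (SMulMemClass.smul_mem _ (sqrt_mem (sub_mem (one_mem _) (pow_mem ha 2))))
    have hsU : star U = a - Complex.I • CFC.sqrt (1 - a ^ 2) := by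
      have hsqrt : star (CFC.sqrt (1 - a ^ 2)) = CFC.sqrt (1 - a ^ 2) :=
        (IsSelfAdjoint.of_nonneg (CFC.sqrt_nonneg (1 - a ^ 2))).star_eq
      rw [hU, star_add, star_smul, hsa.star_eq, hsqrt, Complex.star_def,
        Complex.conj_I, neg_smul, ← sub_eq_add_neg]
    have h2 : a = (2⁻¹ : ℂ) • (U + star U) := by
      rw [hsU, hU, add_add_sub_cancel, ← two_smul ℂ a, smul_smul, inv_mul_cancel₀ two_ne_zero,
        one_smul]
    rw [h2]
    exact S.smul_mem _ (S.add_mem (hS U hUM hUu) (hS _ (star_mem hUM) (Unitary.star_mem hUu)))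
  have hsa : ∀ a ∈ M.toStarSubalgebra, IsSelfAdjoint a → a ∈ S := by
    intro a ha hsa
    have hpos : 0 < ‖a‖ + 1 := by positivity
    have h1 : ((‖a‖ + 1 : ℝ) : ℂ) • ((((‖a‖ + 1)⁻¹ : ℝ) : ℂ) • a) = a := by
      rw [smul_smul, ← Complex.ofReal_mul, mul_inv_cancel₀ hpos.ne', Complex.ofReal_one, one_smul]
    rw [← h1]
    refine S.smul_mem _ (hcontr _ (SMulMemClass.smul_mem _ ha) ?_ ?_)
    · rw [IsSelfAdjoint, star_smul, hsa.star_eq, Complex.star_def, Complex.conj_ofReal]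
    · rw [norm_smul, Complex.norm_real, Real.norm_of_nonneg (inv_nonneg.2 hpos.le),
        inv_mul_le_one₀ hpos]
      exact le_add_of_nonneg_right zero_le_one
  have hD' : D ∈ M.toStarSubalgebra := hD
  have hsplit : D = (2⁻¹ : ℂ) • ((D + star D) - Complex.I • (Complex.I • (D - star D))) := by
    rw [smul_smul, Complex.I_mul_I, neg_one_smul, sub_neg_eq_add, add_add_sub_cancel, ← two_smul ℂ D,
      smul_smul, inv_mul_cancel₀ two_ne_zero, one_smul]
  rw [hsplit]
  refine S.smul_mem _ (S.sub_mem (hsa _ (add_mem hD' (star_mem hD')) ?_)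
    (S.smul_mem _ (hsa _ (SMulMemClass.smul_mem _ (sub_mem hD' (star_mem hD'))) ?_)))
  · rw [IsSelfAdjoint, star_add, star_star, add_comm]
  · rw [IsSelfAdjoint, star_smul, star_sub, star_star, Complex.star_def, Complex.conj_I, neg_smul,
      ← smul_neg, neg_sub]

/-- A closed operator whose graph is invariant under the commutant is a quotient of elements of the
algebra. If `p` is the projection onto the graph, the operator `x ↦ p (x, 0)` has range dense in
the graph, and it commutes with the commutant. The isometric factor `(B, A)` of its polar
decomposition therefore has the graph as its range, and its entries lie in the algebra. -/
theorem mem_affOps_of_invariant {T : H →ₗ.[ℂ] H} (hcl : T.IsClosed)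
    (hinv : ∀ D ∈ M.commutant, D ∈ graphStabilizer T.graph) : T ∈ affOps M := by
  set 𝒢 : Submodule ℂ (WithLp 2 (H × H)) :=
    T.graph.comap ((WithLp.prodContinuousLinearEquiv 2 ℂ H H : WithLp 2 (H × H) →L[ℂ] H × H) :
      WithLp 2 (H × H) →ₗ[ℂ] H × H) with h𝒢
  have hmem : ∀ z : WithLp 2 (H × H), z ∈ 𝒢 ↔ (z.fst, z.snd) ∈ T.graph := fun z => Iff.rfl
  have h𝒢cl : IsClosed (𝒢 : Set (WithLp 2 (H × H))) :=
    IsClosed.preimage (WithLp.prodContinuousLinearEquiv 2 ℂ H H).continuous hcl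
  have : CompleteSpace 𝒢 := h𝒢cl.completeSpace_coe
  have hdiag : ∀ D ∈ M.commutant, ∀ z ∈ 𝒢, diagonal D z ∈ 𝒢 := fun D hD z hz =>
    hinv D hD (z.fst, z.snd) hz
  set p := 𝒢.starProjection with hp
  have hpcomm : ∀ D ∈ M.commutant, ∀ z, p (diagonal D z) = diagonal D (p z) := by
    intro D hD z
    refine Submodule.eq_starProjection_of_mem_orthogonal
      (hdiag D hD _ (𝒢.starProjection_apply_mem z)) ?_
    rw [← map_sub, Submodule.mem_orthogonal]
    intro w hw
    rw [← adjoint_inner_left, adjoint_diagonal]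
    exact (Submodule.mem_orthogonal _ _).1 (𝒢.sub_starProjection_mem_orthogonal z) _
      (hdiag _ (adjoint_mem_commutant hD) w hw)
  set R : H →L[ℂ] WithLp 2 (H × H) := p ∘L column 0 1 with hR
  have hRcomm : ∀ D ∈ M.commutant, ∀ x, R (D x) = diagonal D (R x) := by
    intro D hD x
    change p (column 0 1 (D x)) = diagonal D (p (column 0 1 x))
    rw [← hpcomm D hD]
    exact congrArg p (withLp_prod_ext (by simp) (by simp))
  set P : H →L[ℂ] H := adjoint R ∘L R with hP
  have hPpos : 0 ≤ P := (ContinuousLinearMap.nonneg_iff_isPositive P).2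
    (ContinuousLinearMap.isPositive_adjoint_comp_self R)
  have hPM : P ∈ M.toStarSubalgebra := by
    refine mem_of_commutes fun D hD x => ext_inner_left ℂ fun v => ?_
    change inner ℂ v (adjoint R (R (D x))) = inner ℂ v (D (adjoint R (R x)))
    rw [adjoint_inner_right, ← adjoint_inner_left D, adjoint_inner_right,
      hRcomm _ (adjoint_mem_commutant hD), hRcomm D hD, ← adjoint_diagonal, adjoint_inner_left]
  set V : H →L[ℂ] H := CFC.sqrt P with hV
  have hVM : V ∈ M.toStarSubalgebra := sqrt_mem hPM
  have hVcomm : ∀ D ∈ M.commutant, ∀ x, V (D x) = D (V x) := fun D hD x =>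
    commutes_commutant ⟨V, hVM⟩ hD x
  have hVR : ∀ x, ‖V x‖ = ‖R x‖ := by
    intro x
    have hVs : adjoint V = V := (IsSelfAdjoint.of_nonneg (CFC.sqrt_nonneg P)).star_eq
    have hVV : V (V x) = P x := DFunLike.congr_fun (CFC.sqrt_mul_sqrt_self P hPpos) x
    have h1 : inner ℂ (V x) (V x) = inner ℂ (R x) (R x) := by
      rw [← adjoint_inner_right V, hVs, hVV, hP, ContinuousLinearMap.comp_apply,
        adjoint_inner_right]
    rw [inner_self_eq_norm_sq_to_K, inner_self_eq_norm_sq_to_K] at h1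
    have h2 : ‖V x‖ ^ 2 = ‖R x‖ ^ 2 := by exact_mod_cast h1
    exact (pow_left_inj₀ (norm_nonneg _) (norm_nonneg _) two_ne_zero).1 h2
  -- `‖V x‖ = ‖R x‖` gives factorizations both ways: `R = W V` and `V = W₁ R`
  obtain ⟨W, hW, hW'⟩ := exists_comp_eq_of_norm_le V R 1 fun x => by rw [one_mul, hVR]
  obtain ⟨W₁, hW₁, hW₁'⟩ := exists_comp_eq_of_norm_le R V 1 fun x => by rw [one_mul, hVR]
  have hpR : ∀ x, p (R x) = R x := fun x =>
    Submodule.starProjection_eq_self_iff.2 (𝒢.starProjection_apply_mem _)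
  have hpW : ∀ y, W y ∈ 𝒢 := by
    have : p ∘L W = W := eq_of_eq_on_range_of_eq_on_orthogonal (V := V)
      (fun x => by rw [ContinuousLinearMap.comp_apply, hW, hpR])
      (fun z hz => by rw [ContinuousLinearMap.comp_apply, hW' z hz, map_zero])
    intro y
    rw [← this]
    exact 𝒢.starProjection_apply_mem _
  -- hence every point of the graph is in the range of `W`
  have hWW₁ : W ∘L W₁ = p := by
    refine eq_of_eq_on_range_of_eq_on_orthogonal (V := R)
      (fun x => by rw [ContinuousLinearMap.comp_apply, hW₁, hW, hpR]) fun z hz => ?_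
    rw [ContinuousLinearMap.comp_apply, hW₁' z hz, map_zero]
    -- the first coordinate of `p z` vanishes, and `p z` lies in a graph
    have hpz := 𝒢.starProjection_apply_mem z
    have h1 : (p z).fst = 0 := by
      refine ext_inner_left ℂ fun x => ?_
      have h2 : inner ℂ (R x) z = 0 := (Submodule.mem_orthogonal _ _).1 hz _ ⟨x, rfl⟩
      have h3 : inner ℂ (column 0 1 x) (p z) = inner ℂ (R x) z :=
        (𝒢.inner_starProjection_left_eq_right _ _).symm
      rw [h2, WithLp.prod_inner_apply] at h3
      simpa using h3
    refine (withLp_prod_ext h1 ?_).symm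
    have h4 := (hmem _).1 hpz
    exact T.graph_fst_eq_zero_snd h4 h1
  have hWcomm : ∀ D ∈ M.commutant, ∀ y, W (D y) = diagonal D (W y) := fun D hD y =>
    factor_intertwines hW hW' (hVcomm D hD) (hVcomm _ (adjoint_mem_commutant hD)) (hRcomm D hD) y
  let B : H →L[ℂ] H := (ContinuousLinearMap.fst ℂ H H) ∘L
    (WithLp.prodContinuousLinearEquiv 2 ℂ H H : WithLp 2 (H × H) →L[ℂ] H × H) ∘L W
  let A : H →L[ℂ] H := (ContinuousLinearMap.snd ℂ H H) ∘L
    (WithLp.prodContinuousLinearEquiv 2 ℂ H H : WithLp 2 (H × H) →L[ℂ] H × H) ∘L W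
  have hB : B ∈ M.toStarSubalgebra := mem_of_commutes fun D hD x =>
    congrArg WithLp.fst (hWcomm D hD x)
  have hA : A ∈ M.toStarSubalgebra := mem_of_commutes fun D hD x =>
    congrArg WithLp.snd (hWcomm D hD x)
  have hrange : LinearMap.range ((B : H →ₗ[ℂ] H).prod (A : H →ₗ[ℂ] H)) = T.graph := by
    ext x
    constructor
    · rintro ⟨y, rfl⟩
      exact (hmem _).1 (hpW y)
    · intro hx
      have hx' : WithLp.toLp 2 x ∈ 𝒢 := hx
      refine ⟨W₁ (WithLp.toLp 2 x), ?_⟩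
      have h1 : W (W₁ (WithLp.toLp 2 x)) = WithLp.toLp 2 x :=
        (DFunLike.congr_fun hWW₁ _).trans (Submodule.starProjection_eq_self_iff.2 hx')
      exact congrArg WithLp.ofLp h1
  exact ⟨⟨A, hA⟩, ⟨B, hB⟩, opQuot_eq_of_range_eq_graph hrange⟩

/-- For a unitary `U`, the equation `U* T U = T` says that `U ⊕ U` preserves the graph of `T`, and the
unitaries of the commutant span it. -/
theorem mem_affOps_of_mem_mvnAffOps {T : H →ₗ.[ℂ] H} (hT : T ∈ mvnAffOps M) : T ∈ affOps M := by
  refine mem_affOps_of_invariant hT.1 fun D hD => mem_of_unitary_mem (fun U hU hUu => ?_) hD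
  rintro ⟨x, y⟩ hxy
  have hconj := hT.2 U hU hUu
  have hx : x ∈ T.domain := LinearPMap.mem_domain_of_mem_graph hxy
  have hx2 : x ∈ (conjOp U T).domain := by rw [hconj]; exact hx
  have hUx : U x ∈ T.domain := hx2
  have hval : (conjOp U T) ⟨x, hx2⟩ = y := by
    have h1 : (x, y) ∈ (conjOp U T).graph := by rw [hconj]; exact hxy
    exact (((conjOp U T).image_iff hx2).2 h1).symm
  have hval' : adjoint U (T ⟨U x, hUx⟩) = y := hval
  have hUU : U (adjoint U (T ⟨U x, hUx⟩)) = T ⟨U x, hUx⟩ :=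
    DFunLike.congr_fun (Unitary.mul_star_self_of_mem hUu) _
  change (U x, U y) ∈ T.graph
  rw [← hval', hUU]
  exact T.mem_graph ⟨U x, hUx⟩

theorem conjOp_opQuot {A B : M.toStarSubalgebra}
    (h : LinearMap.ker ((B : H →L[ℂ] H) : H →ₗ[ℂ] H) ≤
      LinearMap.ker ((A : H →L[ℂ] H) : H →ₗ[ℂ] H))
    {U : H →L[ℂ] H} (hU : U ∈ M.commutant) (hUu : U ∈ unitary (H →L[ℂ] H)) :
    conjOp U (opQuot (A : H →L[ℂ] H) (B : H →L[ℂ] H)) =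
      opQuot (A : H →L[ℂ] H) (B : H →L[ℂ] H) := by
  set T := opQuot (A : H →L[ℂ] H) (B : H →L[ℂ] H) with hT
  have hU1 : ∀ x, adjoint U (U x) = x := fun x =>
    DFunLike.congr_fun (Unitary.star_mul_self_of_mem hUu) x
  have hdom : ∀ x, x ∈ T.domain ↔ ∃ z, (B : H →L[ℂ] H) z = x := fun x => by
    rw [hT, opQuot_domain]; rfl
  symm
  refine LinearPMap.eq_of_le_of_domain_eq ⟨?_, ?_⟩ ?_
  · intro x hx
    obtain ⟨z, rfl⟩ := (hdom x).1 hx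
    exact (hdom _).2 ⟨U z, commutes_commutant B hU z⟩
  · rintro ⟨x, hx⟩ ⟨y, hy⟩ hxy
    obtain rfl : x = y := hxy
    obtain ⟨z, rfl⟩ := (hdom x).1 hx
    rw [opQuot_apply h]
    change _ = adjoint U (T ⟨U ((B : H →L[ℂ] H) z), hy⟩)
    have hmem : (B : H →L[ℂ] H) (U z) ∈ T.domain := (hdom _).2 ⟨_, rfl⟩
    have h1 : (⟨U ((B : H →L[ℂ] H) z), hy⟩ : T.domain) = ⟨(B : H →L[ℂ] H) (U z), hmem⟩ :=
      Subtype.ext (commutes_commutant B hU z).symm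
    rw [h1, opQuot_apply h, commutes_commutant A hU, hU1]
  · ext x
    constructor
    · intro hx
      obtain ⟨z, rfl⟩ := (hdom x).1 hx
      exact (hdom _).2 ⟨U z, commutes_commutant B hU z⟩
    · intro hx
      obtain ⟨z, hz⟩ := (hdom (U x)).1 hx
      refine (hdom x).2 ⟨adjoint U z, ?_⟩
      rw [commutes_commutant B (adjoint_mem_commutant hU), hz, hU1]

end Invariance

/-! ### Transport of quotients along a normal homomorphism -/

section Extension

variable {H : Type*} [NormedAddCommGroup H] [InnerProductSpace ℂ H] [CompleteSpace H]
variable {K : Type*} [NormedAddCommGroup K] [InnerProductSpace ℂ K] [CompleteSpace K]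
variable {M : VonNeumannAlgebra H} {N : VonNeumannAlgebra K}
variable {Φ : M.toStarSubalgebra →⋆ₐ[ℂ] N.toStarSubalgebra}

theorem dense_range_iff_ker_star (B : H →L[ℂ] H) :
    Dense (LinearMap.range (B : H →ₗ[ℂ] H) : Set H) ↔
      ∀ x, (star B : H →L[ℂ] H) x = 0 → x = 0 := by
  rw [Submodule.dense_iff_topologicalClosure_eq_top, Submodule.topologicalClosure_eq_top_iff,
    ContinuousLinearMap.orthogonal_range, LinearMap.ker_eq_bot']
  rfl

theorem map_mul_apply (A B : M.toStarSubalgebra) (y : K) :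
    (Φ (A * B) : K →L[ℂ] K) y = (Φ A : K →L[ℂ] K) ((Φ B : K →L[ℂ] K) y) := by
  rw [map_mul]; rfl

theorem range_map_mul_le (B C : M.toStarSubalgebra) :
    LinearMap.range ((Φ (B * C) : K →L[ℂ] K) : K →ₗ[ℂ] K) ≤
      LinearMap.range ((Φ B : K →L[ℂ] K) : K →ₗ[ℂ] K) := by
  rintro _ ⟨y, rfl⟩
  exact ⟨_, (map_mul_apply B C y).symm⟩

theorem range_map_eq_of_range_eq {A B : M.toStarSubalgebra}
    (h : LinearMap.range ((A : H →L[ℂ] H) : H →ₗ[ℂ] H) =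
      LinearMap.range ((B : H →L[ℂ] H) : H →ₗ[ℂ] H)) :
    LinearMap.range ((Φ A : K →L[ℂ] K) : K →ₗ[ℂ] K) =
      LinearMap.range ((Φ B : K →L[ℂ] K) : K →ₗ[ℂ] K) := by
  obtain ⟨C, hC, -⟩ := exists_mul_eq_of_range_le A B h.le
  obtain ⟨D, hD, -⟩ := exists_mul_eq_of_range_le B A h.ge
  refine le_antisymm ?_ ?_
  · rw [← hC]; exact range_map_mul_le B C
  · rw [← hD]; exact range_map_mul_le A D

variable {A B A₁ B₁ : M.toStarSubalgebra}

theorem exists_mul_eq_of_opQuot_le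
    (h : LinearMap.ker ((B : H →L[ℂ] H) : H →ₗ[ℂ] H) ≤
      LinearMap.ker ((A : H →L[ℂ] H) : H →ₗ[ℂ] H))
    (h₁ : LinearMap.ker ((B₁ : H →L[ℂ] H) : H →ₗ[ℂ] H) ≤
      LinearMap.ker ((A₁ : H →L[ℂ] H) : H →ₗ[ℂ] H))
    (hle : opQuot (A : H →L[ℂ] H) (B : H →L[ℂ] H) ≤
      opQuot (A₁ : H →L[ℂ] H) (B₁ : H →L[ℂ] H)) :
    ∃ C : M.toStarSubalgebra, B₁ * C = B ∧ A₁ * C = A ∧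
      ∀ x, (C : H →L[ℂ] H) x ∈ (LinearMap.ker ((B₁ : H →L[ℂ] H) : H →ₗ[ℂ] H))ᗮ := by
  have hdom := hle.1
  rw [opQuot_domain, opQuot_domain] at hdom
  obtain ⟨C, hC, hC'⟩ := exists_mul_eq_of_range_le B B₁ hdom
  refine ⟨C, hC, Subtype.ext (ContinuousLinearMap.ext fun x => ?_), hC'⟩
  have hBC : (B₁ : H →L[ℂ] H) ((C : H →L[ℂ] H) x) = (B : H →L[ℂ] H) x :=
    DFunLike.congr_fun (congrArg Subtype.val hC) x
  have hgr := LinearPMap.le_graph_of_le hle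
  rw [opQuot_graph h, opQuot_graph h₁] at hgr
  obtain ⟨w, hw⟩ := hgr ⟨x, rfl⟩
  have hw1 : (B₁ : H →L[ℂ] H) w = (B : H →L[ℂ] H) x := congrArg Prod.fst hw
  have hw2 : (A₁ : H →L[ℂ] H) w = (A : H →L[ℂ] H) x := congrArg Prod.snd hw
  have hk : (A₁ : H →L[ℂ] H) ((C : H →L[ℂ] H) x - w) = 0 :=
    h₁ (show (B₁ : H →L[ℂ] H) ((C : H →L[ℂ] H) x - w) = 0 by rw [map_sub, hBC, hw1, sub_self])
  rw [map_sub, hw2, sub_eq_zero] at hk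
  exact hk

theorem range_prod_map_le {C : M.toStarSubalgebra} (hB : B₁ * C = B) (hA : A₁ * C = A) :
    LinearMap.range (((Φ B : K →L[ℂ] K) : K →ₗ[ℂ] K).prod ((Φ A : K →L[ℂ] K) : K →ₗ[ℂ] K)) ≤
      LinearMap.range
        (((Φ B₁ : K →L[ℂ] K) : K →ₗ[ℂ] K).prod ((Φ A₁ : K →L[ℂ] K) : K →ₗ[ℂ] K)) := by
  subst hB hA
  rintro _ ⟨y, rfl⟩
  exact ⟨(Φ C : K →L[ℂ] K) y, Prod.ext (map_mul_apply _ _ _).symm (map_mul_apply _ _ _).symm⟩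

theorem opQuot_map_eq_of_opQuot_eq
    (h : LinearMap.ker ((B : H →L[ℂ] H) : H →ₗ[ℂ] H) ≤
      LinearMap.ker ((A : H →L[ℂ] H) : H →ₗ[ℂ] H))
    (h₁ : LinearMap.ker ((B₁ : H →L[ℂ] H) : H →ₗ[ℂ] H) ≤
      LinearMap.ker ((A₁ : H →L[ℂ] H) : H →ₗ[ℂ] H))
    (heq : opQuot (A : H →L[ℂ] H) (B : H →L[ℂ] H) =
      opQuot (A₁ : H →L[ℂ] H) (B₁ : H →L[ℂ] H)) :
    opQuot (Φ A : K →L[ℂ] K) (Φ B : K →L[ℂ] K) =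
      opQuot (Φ A₁ : K →L[ℂ] K) (Φ B₁ : K →L[ℂ] K) := by
  obtain ⟨C, hB, hA, -⟩ := exists_mul_eq_of_opQuot_le h h₁ heq.le
  obtain ⟨D, hB', hA', -⟩ := exists_mul_eq_of_opQuot_le h₁ h heq.ge
  exact congrArg Submodule.toLinearPMap
    (le_antisymm (range_prod_map_le hB hA) (range_prod_map_le hB' hA'))

theorem phiAff_eq (h : LinearMap.ker ((B : H →L[ℂ] H) : H →ₗ[ℂ] H) ≤
      LinearMap.ker ((A : H →L[ℂ] H) : H →ₗ[ℂ] H)) (T : affOps M)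
    (hT : T.1 = opQuot (A : H →L[ℂ] H) (B : H →L[ℂ] H)) :
    phiAff Φ T = opQuot (Φ A : K →L[ℂ] K) (Φ B : K →L[ℂ] K) :=
  opQuot_map_eq_of_opQuot_eq T.2.choose_spec.choose_spec.1 h
    (T.2.choose_spec.choose_spec.2.symm.trans hT)

theorem phiAffS_eq (V : affSubspaces M)
    (hV : V.1 = LinearMap.range ((A : H →L[ℂ] H) : H →ₗ[ℂ] H)) :
    phiAffS Φ V = LinearMap.range ((Φ A : K →L[ℂ] K) : K →ₗ[ℂ] K) :=
  range_map_eq_of_range_eq (V.2.choose_spec.symm.trans hV)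

/-- Dense range of `B` is the inclusion `ker B* ≤ ker 1`. -/
theorem isDenselyDefined_opQuot_map (hΦ : IsNormalHom Φ)
    (h : IsDenselyDefined (opQuot (A : H →L[ℂ] H) (B : H →L[ℂ] H))) :
    IsDenselyDefined (opQuot (Φ A : K →L[ℂ] K) (Φ B : K →L[ℂ] K)) := by
  rw [IsDenselyDefined, opQuot_domain, dense_range_iff_ker_star] at h ⊢
  have hker : LinearMap.ker (((star B : M.toStarSubalgebra) : H →L[ℂ] H) : H →ₗ[ℂ] H) ≤
      LinearMap.ker (((1 : M.toStarSubalgebra) : H →L[ℂ] H) : H →ₗ[ℂ] H) := fun x hx => h x hx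
  intro y hy
  have hy' : (Φ (star B) : K →L[ℂ] K) y = 0 := by rw [map_star]; exact hy
  have h1 : (Φ 1 : K →L[ℂ] K) y = 0 := ker_map_le hΦ hker hy'
  rwa [map_one] at h1

theorem isBddOp_opQuot_map
    (h : LinearMap.ker ((B : H →L[ℂ] H) : H →ₗ[ℂ] H) ≤
      LinearMap.ker ((A : H →L[ℂ] H) : H →ₗ[ℂ] H))
    (hb : IsBddOp (opQuot (A : H →L[ℂ] H) (B : H →L[ℂ] H))) :
    IsBddOp (opQuot (Φ A : K →L[ℂ] K) (Φ B : K →L[ℂ] K)) := by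
  obtain ⟨c, hc⟩ := hb
  obtain ⟨W, rfl⟩ := exists_mul_eq_of_norm_le A B c fun x => by
    have hx : (B : H →L[ℂ] H) x ∈ (opQuot (A : H →L[ℂ] H) (B : H →L[ℂ] H)).domain := by
      rw [opQuot_domain]; exact ⟨x, rfl⟩
    rw [← opQuot_apply h x hx]
    exact hc ⟨_, hx⟩
  have hk : LinearMap.ker ((Φ B : K →L[ℂ] K) : K →ₗ[ℂ] K) ≤
      LinearMap.ker ((Φ (W * B) : K →L[ℂ] K) : K →ₗ[ℂ] K) := by
    intro y hy
    have hy' : (Φ B : K →L[ℂ] K) y = 0 := hy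
    change (Φ (W * B) : K →L[ℂ] K) y = 0
    rw [map_mul_apply, hy', map_zero]
  refine ⟨‖(Φ W : K →L[ℂ] K)‖, ?_⟩
  rintro ⟨x, hx⟩
  have hx' := hx
  rw [opQuot_domain] at hx'
  obtain ⟨y, rfl⟩ := hx'
  refine (congrArg norm (opQuot_apply hk y hx)).trans_le ?_
  rw [map_mul_apply]
  exact (Φ W : K →L[ℂ] K).le_opNorm _

/-- The graph of `Φ(A) / Φ(B)` is the range of an operator with a left inverse modulo its kernel:
the left inverse `(D₁, D₂)` of `(B, A)` is carried over by `Φ`. -/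
theorem isClosed_opQuot_map (hΦ : IsNormalHom Φ)
    (h : LinearMap.ker ((B : H →L[ℂ] H) : H →ₗ[ℂ] H) ≤
      LinearMap.ker ((A : H →L[ℂ] H) : H →ₗ[ℂ] H))
    (hcl : (opQuot (A : H →L[ℂ] H) (B : H →L[ℂ] H)).IsClosed) :
    (opQuot (Φ A : K →L[ℂ] K) (Φ B : K →L[ℂ] K)).IsClosed := by
  rw [LinearPMap.IsClosed, opQuot_graph h] at hcl
  rw [LinearPMap.IsClosed, opQuot_graph (ker_map_le hΦ h)]
  obtain ⟨D₁, D₂, hD⟩ := exists_left_inverse_of_isClosed h hcl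
  let V : K →L[ℂ] K × K := (Φ B : K →L[ℂ] K).prod (Φ A : K →L[ℂ] K)
  let F : K × K →L[ℂ] K := (Φ D₁ : K →L[ℂ] K) ∘L ContinuousLinearMap.fst ℂ K K +
    (Φ D₂ : K →L[ℂ] K) ∘L ContinuousLinearMap.snd ℂ K K
  have hFV : ∀ y, F (V y) = (Φ (rightSupport B) : K →L[ℂ] K) y := by
    intro y
    rw [← hD, map_add]
    change (Φ D₁ : K →L[ℂ] K) ((Φ B : K →L[ℂ] K) y) + (Φ D₂ : K →L[ℂ] K) ((Φ A : K →L[ℂ] K) y) =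
      (Φ (D₁ * B) : K →L[ℂ] K) y + (Φ (D₂ * A) : K →L[ℂ] K) y
    rw [map_mul_apply, map_mul_apply]
  have hVQ : ∀ y, V ((Φ (rightSupport B) : K →L[ℂ] K) y) = V y := by
    intro y
    refine Prod.ext ?_ ?_
    · change (Φ B : K →L[ℂ] K) _ = (Φ B : K →L[ℂ] K) y
      rw [← map_mul_apply, mul_rightSupport_of_ker_le le_rfl]
    · change (Φ A : K →L[ℂ] K) _ = (Φ A : K →L[ℂ] K) y
      rw [← map_mul_apply, mul_rightSupport_of_ker_le h]
  -- the range of `V` is the fixed-point set of the continuous map `V ∘ F`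
  have hset : (LinearMap.range (((Φ B : K →L[ℂ] K) : K →ₗ[ℂ] K).prod
      ((Φ A : K →L[ℂ] K) : K →ₗ[ℂ] K)) : Set (K × K)) = {z | V (F z) = z} := by
    ext z
    constructor
    · rintro ⟨y, rfl⟩
      change V (F (V y)) = V y
      rw [hFV, hVQ]
    · intro hz
      exact ⟨F z, hz⟩
  rw [hset]
  exact isClosed_eq (V.continuous.comp F.continuous) continuous_id

/-- If `B = B₁ C` and the graph of `A / B` is dense in the closed graph of `A₁ / B₁`, then the range
of `C` is dense in `(ker B₁)ᗮ`, stated here for the orthogonal complements of the two spaces. -/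
theorem ker_star_le_ker_rightSupport {C : M.toStarSubalgebra}
    (h₁ : LinearMap.ker ((B₁ : H →L[ℂ] H) : H →ₗ[ℂ] H) ≤
      LinearMap.ker ((A₁ : H →L[ℂ] H) : H →ₗ[ℂ] H))
    (hB : B₁ * C = B) (hA : A₁ * C = A)
    (hC : ∀ x, (C : H →L[ℂ] H) x ∈ (LinearMap.ker ((B₁ : H →L[ℂ] H) : H →ₗ[ℂ] H))ᗮ)
    (hcl : (LinearMap.range
      (((B : H →L[ℂ] H) : H →ₗ[ℂ] H).prod ((A : H →L[ℂ] H) : H →ₗ[ℂ] H))).topologicalClosure =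
      LinearMap.range (((B₁ : H →L[ℂ] H) : H →ₗ[ℂ] H).prod ((A₁ : H →L[ℂ] H) : H →ₗ[ℂ] H))) :
    LinearMap.ker (((star C : M.toStarSubalgebra) : H →L[ℂ] H) : H →ₗ[ℂ] H) ≤
      LinearMap.ker ((rightSupport B₁ : H →L[ℂ] H) : H →ₗ[ℂ] H) := by
  obtain ⟨D₁, D₂, hD⟩ := exists_left_inverse_of_isClosed h₁
    (hcl ▸ Submodule.isClosed_topologicalClosure _)
  let F : H × H →L[ℂ] H := (D₁ : H →L[ℂ] H) ∘L ContinuousLinearMap.fst ℂ H H +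
    (D₂ : H →L[ℂ] H) ∘L ContinuousLinearMap.snd ℂ H H
  have hF : ∀ x, F ((B₁ : H →L[ℂ] H) x, (A₁ : H →L[ℂ] H) x) = (rightSupport B₁ : H →L[ℂ] H) x :=
    fun x => DFunLike.congr_fun (congrArg Subtype.val hD) x
  subst hB hA
  intro z hz
  have hz' : adjoint (C : H →L[ℂ] H) z = 0 := hz
  have hzero : ∀ w ∈ (LinearMap.range
      ((((B₁ * C : M.toStarSubalgebra) : H →L[ℂ] H) : H →ₗ[ℂ] H).prod
        (((A₁ * C : M.toStarSubalgebra) : H →L[ℂ] H) : H →ₗ[ℂ] H))).topologicalClosure,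
      inner ℂ z (F w) = 0 := by
    have hc : IsClosed {w : H × H | inner ℂ z (F w) = 0} :=
      isClosed_eq (continuous_const.inner F.continuous) continuous_const
    intro w hw
    refine closure_minimal ?_ hc hw
    rintro _ ⟨x, rfl⟩
    change inner ℂ z (F ((B₁ : H →L[ℂ] H) ((C : H →L[ℂ] H) x),
      (A₁ : H →L[ℂ] H) ((C : H →L[ℂ] H) x))) = 0
    rw [hF, rightSupport_apply_eq_self _ (hC x), ← adjoint_inner_left, hz', inner_zero_left]
  change (rightSupport B₁ : H →L[ℂ] H) z = 0
  refine ext_inner_right ℂ fun x => ?_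
  have hs : adjoint (rightSupport B₁ : H →L[ℂ] H) = (rightSupport B₁ : H →L[ℂ] H) :=
    congrArg Subtype.val (star_rightSupport B₁)
  rw [← hs, adjoint_inner_left, inner_zero_left, ← hF]
  exact hzero _ (hcl ▸ ⟨x, rfl⟩)

/-- `Φ` carries the factor `C` with range dense in `(ker B₁)ᗮ` to one with range dense in
`(ker Φ(B₁))ᗮ`, so density of the graph of `A / B` in that of `A₁ / B₁` is preserved. -/
theorem closure_graph_opQuot_map (hΦ : IsNormalHom Φ)
    (h : LinearMap.ker ((B : H →L[ℂ] H) : H →ₗ[ℂ] H) ≤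
      LinearMap.ker ((A : H →L[ℂ] H) : H →ₗ[ℂ] H))
    (h₁ : LinearMap.ker ((B₁ : H →L[ℂ] H) : H →ₗ[ℂ] H) ≤
      LinearMap.ker ((A₁ : H →L[ℂ] H) : H →ₗ[ℂ] H))
    (hcl : (opQuot (A : H →L[ℂ] H) (B : H →L[ℂ] H)).graph.topologicalClosure =
      (opQuot (A₁ : H →L[ℂ] H) (B₁ : H →L[ℂ] H)).graph) :
    (opQuot (Φ A : K →L[ℂ] K) (Φ B : K →L[ℂ] K)).graph.topologicalClosure =
      (opQuot (Φ A₁ : K →L[ℂ] K) (Φ B₁ : K →L[ℂ] K)).graph := by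
  have hclosed₁ : (opQuot (A₁ : H →L[ℂ] H) (B₁ : H →L[ℂ] H)).IsClosed := by
    rw [LinearPMap.IsClosed, ← hcl]
    exact Submodule.isClosed_topologicalClosure _
  have hclosedΦ := isClosed_opQuot_map hΦ h₁ hclosed₁
  have hle : opQuot (A : H →L[ℂ] H) (B : H →L[ℂ] H) ≤
      opQuot (A₁ : H →L[ℂ] H) (B₁ : H →L[ℂ] H) :=
    LinearPMap.le_of_le_graph (hcl ▸ Submodule.le_topologicalClosure _)
  obtain ⟨C, hB, hA, hC⟩ := exists_mul_eq_of_opQuot_le h h₁ hle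
  rw [opQuot_graph h, opQuot_graph h₁] at hcl
  rw [LinearPMap.IsClosed, opQuot_graph (ker_map_le hΦ h₁)] at hclosedΦ
  rw [opQuot_graph (ker_map_le hΦ h), opQuot_graph (ker_map_le hΦ h₁)]
  refine le_antisymm
    (Submodule.topologicalClosure_minimal _ (range_prod_map_le hB hA) hclosedΦ) ?_
  have hker := ker_map_le hΦ (ker_star_le_ker_rightSupport h₁ hB hA hC hcl)
  set Q := rightSupport B₁ with hQ
  have hQs : adjoint (Φ Q : K →L[ℂ] K) = (Φ Q : K →L[ℂ] K) := by
    have : star (Φ Q) = Φ Q := by rw [← map_star, star_rightSupport]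
    exact congrArg Subtype.val this
  have hdense : ∀ y, (Φ Q : K →L[ℂ] K) y ∈
      (LinearMap.range ((Φ C : K →L[ℂ] K) : K →ₗ[ℂ] K)).topologicalClosure := by
    intro y
    rw [← Submodule.orthogonal_orthogonal_eq_closure, ContinuousLinearMap.orthogonal_range,
      Submodule.mem_orthogonal]
    intro w hw
    have hw' : (Φ (star C) : K →L[ℂ] K) w = 0 := by rw [map_star]; exact hw
    have hQw : (Φ Q : K →L[ℂ] K) w = 0 := hker hw'
    rw [← adjoint_inner_left, hQs, hQw, inner_zero_left]
  let V : K →L[ℂ] K × K := (Φ B₁ : K →L[ℂ] K).prod (Φ A₁ : K →L[ℂ] K)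
  rintro _ ⟨y, rfl⟩
  have hVQ : V ((Φ Q : K →L[ℂ] K) y) = V y := by
    refine Prod.ext ?_ ?_
    · change (Φ B₁ : K →L[ℂ] K) _ = (Φ B₁ : K →L[ℂ] K) y
      rw [← map_mul_apply, mul_rightSupport_of_ker_le le_rfl]
    · change (Φ A₁ : K →L[ℂ] K) _ = (Φ A₁ : K →L[ℂ] K) y
      rw [← map_mul_apply, mul_rightSupport_of_ker_le h₁]
  change V y ∈ _
  rw [← hVQ]
  have hmaps : Set.MapsTo V (LinearMap.range ((Φ C : K →L[ℂ] K) : K →ₗ[ℂ] K))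
      (LinearMap.range
        (((Φ B : K →L[ℂ] K) : K →ₗ[ℂ] K).prod ((Φ A : K →L[ℂ] K) : K →ₗ[ℂ] K))) := by
    rintro _ ⟨w, rfl⟩
    subst hB hA
    exact ⟨w, Prod.ext (map_mul_apply _ _ _) (map_mul_apply _ _ _)⟩
  exact hmaps.closure V.continuous (hdense y)

theorem closure_mem_affOps {T : H →ₗ.[ℂ] H} (hT : T ∈ affOps M) (hcl : T.IsClosable) :
    T.closure ∈ affOps M := by
  obtain ⟨A, B, h, rfl⟩ := hT
  refine mem_affOps_of_invariant hcl.closure_isClosed fun D hD => ?_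
  rw [← hcl.graph_closure_eq_closure_graph]
  refine mem_graphStabilizer_topologicalClosure ?_
  rw [opQuot_graph h]
  rintro _ ⟨x, rfl⟩
  exact ⟨D x, Prod.ext (commutes_commutant B hD x) (commutes_commutant A hD x)⟩

end Extension

end

theorem mainTheorem7
    {H : Type*} [NormedAddCommGroup H] [InnerProductSpace ℂ H] [CompleteSpace H]
    {K : Type*} [NormedAddCommGroup K] [InnerProductSpace ℂ K] [CompleteSpace K]
    (M : VonNeumannAlgebra H) (N : VonNeumannAlgebra K)
    (Φ : M.toStarSubalgebra →⋆ₐ[ℂ] N.toStarSubalgebra) (hΦ : IsNormalHom Φ) :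
    -- `Φ_aff^s` is independent of the operator chosen to represent the subspace
    (∀ (A : M.toStarSubalgebra) (V : affSubspaces M),
      V.1 = LinearMap.range ((A : H →L[ℂ] H) : H →ₗ[ℂ] H) →
        phiAffS Φ V = LinearMap.range ((Φ A : K →L[ℂ] K) : K →ₗ[ℂ] K)) ∧
    -- `Φ_aff` is independent of the chosen quotient representation
    (∀ (A B : M.toStarSubalgebra) (T : affOps M),
      LinearMap.ker ((B : H →L[ℂ] H) : H →ₗ[ℂ] H) ≤
          LinearMap.ker ((A : H →L[ℂ] H) : H →ₗ[ℂ] H) →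
        T.1 = opQuot (A : H →L[ℂ] H) (B : H →L[ℂ] H) →
          LinearMap.ker ((Φ B : K →L[ℂ] K) : K →ₗ[ℂ] K) ≤
              LinearMap.ker ((Φ A : K →L[ℂ] K) : K →ₗ[ℂ] K) ∧
            phiAff Φ T = opQuot (Φ A : K →L[ℂ] K) (Φ B : K →L[ℂ] K)) ∧
    (∀ T : affOps M,
      -- `Φ_aff` takes values in the affiliated operators of `N`
      phiAff Φ T ∈ affOps N ∧
      -- (i)
      ((phiAff Φ T).domain = phiAffS Φ ⟨T.1.domain, domain_mem_affSubspaces T⟩ ∧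
        (IsDenselyDefined T.1 → IsDenselyDefined (phiAff Φ T))) ∧
      -- (ii)
      (T.1.IsClosed ∧ IsBddOp T.1 → (phiAff Φ T).IsClosed ∧ IsBddOp (phiAff Φ T)) ∧
      -- (iii)
      (T.1.IsClosed → (phiAff Φ T).IsClosed) ∧
      -- (iv)
      (T.1.IsClosable → (phiAff Φ T).IsClosable ∧
        ∃ hT : T.1.closure ∈ affOps M, phiAff Φ ⟨T.1.closure, hT⟩ = (phiAff Φ T).closure)) ∧
    -- closed affiliated operators are mapped to closed affiliated operators
    (∀ T ∈ mvnAffOps M, ∃ hT : T ∈ affOps M,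
      phiAff Φ ⟨T, hT⟩ ∈ mvnAffOps N ∧
        (IsDenselyDefined T → IsDenselyDefined (phiAff Φ ⟨T, hT⟩))) := by

  have hrep : ∀ T : affOps M, ∃ A B : M.toStarSubalgebra,
      LinearMap.ker ((B : H →L[ℂ] H) : H →ₗ[ℂ] H) ≤ LinearMap.ker ((A : H →L[ℂ] H) : H →ₗ[ℂ] H) ∧
        T.1 = opQuot (A : H →L[ℂ] H) (B : H →L[ℂ] H) ∧
        phiAff Φ T = opQuot (Φ A : K →L[ℂ] K) (Φ B : K →L[ℂ] K) := by
    intro T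
    obtain ⟨A, B, h, hT⟩ := T.2
    exact ⟨A, B, h, hT, phiAff_eq h T hT⟩
  refine ⟨fun A V hV => phiAffS_eq V hV,
    fun A B T h hT => ⟨ker_map_le hΦ h, phiAff_eq h T hT⟩, fun T => ?_, fun T hT => ?_⟩
  · obtain ⟨A, B, h, hT, hΦT⟩ := hrep T
    refine ⟨⟨Φ A, Φ B, ker_map_le hΦ h, hΦT⟩, ⟨?_, ?_⟩, ?_, ?_, ?_⟩
    · rw [hΦT, opQuot_domain]
      exact (phiAffS_eq _ ((congrArg LinearPMap.domain hT).trans (opQuot_domain _ _))).symm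
    · rw [hΦT, hT]
      exact isDenselyDefined_opQuot_map hΦ
    · rw [hΦT, hT]
      exact fun hcl => ⟨isClosed_opQuot_map hΦ h hcl.1, isBddOp_opQuot_map h hcl.2⟩
    · rw [hΦT, hT]
      exact isClosed_opQuot_map hΦ h
    · intro hcl
      have hmem := closure_mem_affOps T.2 hcl
      obtain ⟨A₁, B₁, h₁, hT₁, hΦT₁⟩ := hrep ⟨T.1.closure, hmem⟩
      have hgraph := hcl.graph_closure_eq_closure_graph
      have hT₁' : T.1.closure = opQuot (A₁ : H →L[ℂ] H) (B₁ : H →L[ℂ] H) := hT₁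
      rw [hT₁', hT] at hgraph
      have hΦgraph := closure_graph_opQuot_map hΦ h h₁ hgraph
      rw [← hΦT, ← hΦT₁] at hΦgraph
      have hΦcl : (phiAff Φ T).IsClosable := ⟨_, hΦgraph⟩
      exact ⟨hΦcl, hmem, LinearPMap.eq_of_eq_graph
        (hΦgraph.symm.trans hΦcl.graph_closure_eq_closure_graph)⟩
  · have hmem := mem_affOps_of_mem_mvnAffOps hT
    obtain ⟨A, B, h, hT', hΦT⟩ := hrep ⟨T, hmem⟩
    obtain rfl : T = opQuot (A : H →L[ℂ] H) (B : H →L[ℂ] H) := hT'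
    refine ⟨hmem, ⟨?_, fun U hU hUu => ?_⟩, ?_⟩
    · rw [hΦT]
      exact isClosed_opQuot_map hΦ h hT.1
    · rw [hΦT]
      exact conjOp_opQuot (ker_map_le hΦ h) hU hUu
    · rw [hΦT]
      exact isDenselyDefined_opQuot_map hΦ
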